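/- Let $d\ge 2$, $T>0$, and let $\mathbb T^d=\mathbb R^d/\mathbb Z^d$. Let $u\in L^\infty(\mathbb T^d;\mathbb R^d)$ be a time-independent vector field that is divergence-free in the sense of distributions, and let $\theta_{\rm in}\in C^2(\mathbb T^d)$. For every $\kappa\in(0,1)$ let $\theta_\kappa\in L^\infty((0,T)\times\mathbb T^d)\cap L^2(0,T;H^1(\mathbb T^d))$ be the weak solution of $$\partial_t\theta_\kappa+u\cdot\nabla\theta_\kappa=\kappa\Delta\theta_\kappa\ \text{ on }(0,T)\times\mathbb T^d,\qquad \theta_\kappa(0,\cdot)=\theta_{\rm in},$$ that is, $\int_0^T\!\!\int_{\mathbb T^d}\big(\theta_\kappa(\partial_t\varphi+u\cdot\nabla\varphi)-\kappa\nabla\theta_\kappa\cdot\nabla\varphi\big)\,dx\,dt+\int_{\mathbb T^d}\theta_{\rm in}\,\varphi(0,\cdot)\,dx=0$ for all $\varphi\in C_c^\infty([0,T)\times\mathbb T^d)$. Then: 1. For every $\kappa\in(0,1)$ the distributional derivative $\partial_t\theta_\kappa$ belongs to $L^\infty((0,T)\times\mathbb T^d)$, and $$\sup_{\kappa\in(0,1)}\|\partial_t\theta_\kappa\|_{L^\infty((0,T)\times\mathbb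 T^d)}\le\|u\|_{L^\infty}\|\theta_{\rm in}\|_{C^1}+\|\theta_{\rm in}\|_{C^2},$$ where $\|f\|_{C^k}=\sum_{|\alpha|\le k}\sup_{\mathbb T^d}|\partial^\alpha f|$. 2. Every sequence $\kappa_n\to0$ in $(0,1)$ has a subsequence (not relabelled) along which $t\mapsto\kappa_n\int_{\mathbb T^d}|\nabla\theta_{\kappa_n}(t,x)|^2\,dx$ (each of these functions being in $L^\infty(0,T)$) converges weak* in $L^\infty(0,T)$ to some $f\in L^\infty(0,T)$. 3. If $\kappa_n\to0$ is a sequence in $(0,1)$ and $\theta_{\kappa_n}$ converges weak* in $L^\infty((0,T)\times\mathbb T^d)$ to $\theta$, then the energy $e(t)=\int_{\mathbb T^d}|\theta(t,x)|^2\,dx$ belongs to $W^{1,\infty}(0,T)$. -/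

import Mathlib

open MeasureTheory Set Filter Topology
open scoped ContDiff ENNReal

namespace AdvDiff

/-- The flat torus `ℝ^d / ℤ^d`; its `volume` is the normalized Lebesgue (Haar) measure. -/
abbrev Torus (d : ℕ) : Type := UnitAddTorus (Fin d)

/-- The projection `ℝ^d → ℝ^d / ℤ^d`. -/
def toTorus {d : ℕ} (y : Fin d → ℝ) : Torus d := fun i => (y i : UnitAddCircle)

/-- `f` is of class `C^n` on the torus: its `ℤ^d`-periodic lift to `ℝ^d` is of class `C^n`. -/
def TorusContDiff {d : ℕ} (n : ℕ∞) (f : Torus d → ℝ) : Prop :=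
  ContDiff ℝ n (fun y : Fin d → ℝ => f (toTorus y))

/-- The `i`-th partial derivative of a function on the torus. -/
noncomputable def partialDeriv {d : ℕ} (i : Fin d) (f : Torus d → ℝ) (x : Torus d) : ℝ :=
  deriv (fun h : ℝ => f (x + Pi.single i (h : UnitAddCircle))) 0

/-- The classical gradient of a function on the torus. -/
noncomputable def grad {d : ℕ} (f : Torus d → ℝ) (x : Torus d) : EuclideanSpace ℝ (Fin d) :=
  WithLp.toLp 2 (fun i => partialDeriv i f x)

/-- The supremum norm (used for continuous functions on the torus). -/
noncomputable def supNorm {d : ℕ} (f : Torus d → ℝ) : ℝ := ⨆ x, |f x|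

/-- The `C^1` norm: the sum of `sup |∂^α f|` over the multi-indices `|α| ≤ 1`. -/
noncomputable def normC1 {d : ℕ} (f : Torus d → ℝ) : ℝ :=
  supNorm f + ∑ i, supNorm (partialDeriv i f)

/-- The `C^2` norm: the sum of `sup |∂^α f|` over the multi-indices `|α| ≤ 2`
(a multi-index of length two is a pair `i ≤ j`). -/
noncomputable def normC2 {d : ℕ} (f : Torus d → ℝ) : ℝ :=
  normC1 f + ∑ i, ∑ j ∈ Finset.Ici i, supNorm (partialDeriv i (partialDeriv j f))

/-- Lebesgue measure on the time interval `(0,T)`. -/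
noncomputable abbrev timeMeasure (T : ℝ) : Measure ℝ := volume.restrict (Ioo 0 T)

/-- Lebesgue measure on `(0,T) × 𝕋^d`. -/
noncomputable abbrev spaceTimeMeasure (d : ℕ) (T : ℝ) : Measure (ℝ × Torus d) :=
  (timeMeasure T).prod volume

/-- Smooth compactly supported functions of `(t,x) ∈ ℝ × 𝕋^d`
whose support lies over the time set `I`. -/
structure IsTestFunction {d : ℕ} (I : Set ℝ) (φ : ℝ × Torus d → ℝ) : Prop where
  smooth : ContDiff ℝ ∞ (fun p : ℝ × (Fin d → ℝ) => φ (p.1, toTorus p.2))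
  compact : HasCompactSupport φ
  support : tsupport φ ⊆ I ×ˢ univ

/-- Classical time derivative. -/
noncomputable def timeDeriv {d : ℕ} (φ : ℝ × Torus d → ℝ) (p : ℝ × Torus d) : ℝ :=
  deriv (fun s : ℝ => φ (s, p.2)) p.1

/-- Classical spatial gradient. -/
noncomputable def spaceGrad {d : ℕ} (φ : ℝ × Torus d → ℝ) (p : ℝ × Torus d) :
    EuclideanSpace ℝ (Fin d) :=
  grad (fun x => φ (p.1, x)) p.2

/-- `div u = 0` in the sense of distributions on the torus. -/
def IsDivFree {d : ℕ} (u : Torus d → EuclideanSpace ℝ (Fin d)) : Prop :=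
  ∀ φ : Torus d → ℝ, TorusContDiff ⊤ φ → ∫ x, inner ℝ (u x) (grad φ x) = 0

/-- `g = ∂_t θ` in the sense of distributions on `(0,T) × 𝕋^d`. -/
def HasWeakTimeDeriv {d : ℕ} (T : ℝ) (θ g : ℝ × Torus d → ℝ) : Prop :=
  ∀ φ : ℝ × Torus d → ℝ, IsTestFunction (Ioo 0 T) φ →
    ∫ p, θ p * timeDeriv φ p ∂(spaceTimeMeasure d T) =
      -∫ p, g p * φ p ∂(spaceTimeMeasure d T)

/-- `G = ∇ θ` (gradient in space) in the sense of distributions on `(0,T) × 𝕋^d`. -/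
def HasWeakSpaceGrad {d : ℕ} (T : ℝ) (θ : ℝ × Torus d → ℝ)
    (G : ℝ × Torus d → EuclideanSpace ℝ (Fin d)) : Prop :=
  ∀ φ : ℝ × Torus d → ℝ, IsTestFunction (Ioo 0 T) φ → ∀ i : Fin d,
    ∫ p, θ p * spaceGrad φ p i ∂(spaceTimeMeasure d T) =
      -∫ p, G p i * φ p ∂(spaceTimeMeasure d T)

/-- `θ ∈ L^∞((0,T) × 𝕋^d) ∩ L^2(0,T; H^1(𝕋^d))`, with spatial gradient `G`, is the weak solution of
`∂_t θ + u · ∇θ = κ Δθ` on `(0,T) × 𝕋^d`, with `θ(0,·) = θ₀`, for a divergence-free field `u`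
independent of time. -/
structure IsWeakSolution {d : ℕ} (T : ℝ) (u : Torus d → EuclideanSpace ℝ (Fin d)) (κ : ℝ)
    (θ₀ : Torus d → ℝ) (θ : ℝ × Torus d → ℝ)
    (G : ℝ × Torus d → EuclideanSpace ℝ (Fin d)) : Prop where
  bounded : MemLp θ ∞ (spaceTimeMeasure d T)
  grad_memLp : MemLp G 2 (spaceTimeMeasure d T)
  hasGrad : HasWeakSpaceGrad T θ G
  /-- The equation with its initial condition, tested on `C_c^∞([0,T) × 𝕋^d)`. -/
  equation : ∀ φ : ℝ × Torus d → ℝ, IsTestFunction (Iio T) φ →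
    (∫ p, (θ p * (timeDeriv φ p + inner ℝ (u p.2) (spaceGrad φ p))
        - κ * inner ℝ (G p) (spaceGrad φ p)) ∂(spaceTimeMeasure d T))
      + ∫ x, θ₀ x * φ (0, x) = 0

/-- Weak-* convergence `F n ⇀* f` in `L^∞(μ)`, as the dual of `L^1(μ)`. -/
def TendstoWeakStar {α : Type*} [MeasurableSpace α] (μ : Measure α) (F : ℕ → α → ℝ)
    (f : α → ℝ) : Prop :=
  (∀ n, MemLp (F n) ∞ μ) ∧ MemLp f ∞ μ ∧
    ∀ ψ : α → ℝ, Integrable ψ μ →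
      Tendsto (fun n => ∫ a, F n a * ψ a ∂μ) atTop (𝓝 (∫ a, f a * ψ a ∂μ))

/-- `e ∈ W^{1,∞}(0,T)`: `e` and its distributional derivative belong to `L^∞(0,T)`. -/
def MemW1Infty (T : ℝ) (e : ℝ → ℝ) : Prop :=
  MemLp e ∞ (timeMeasure T) ∧ ∃ e' : ℝ → ℝ, MemLp e' ∞ (timeMeasure T) ∧
    ∀ φ : ℝ → ℝ, ContDiff ℝ ∞ φ → HasCompactSupport φ → tsupport φ ⊆ Ioo 0 T →
      ∫ t, e t * deriv φ t ∂(timeMeasure T) = -∫ t, e' t * φ t ∂(timeMeasure T)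

end AdvDiff

open AdvDiff

namespace AdvDiff

variable {d : ℕ}

/-! Because `u` does not depend on time, `∂_t θ_κ` formally solves the same advection–diffusion
equation, with initial value `κ Δθ₀ - u · ∇θ₀`. Since `κ < 1`, this is bounded by `C = ‖u‖_∞
‖θ₀‖_{C¹} + ‖θ₀‖_{C²}`, and the maximum principle propagates the bound: `|∂_t θ_κ| ≤ C`, uniformly
in `κ`. The other two claims are consequences of this Lipschitz bound in time.

To justify this for weak solutions, one passes to `w = θ - θ₀`, which has zero initial value and
time-independent forcing `-F`, where `F = u · ∇θ₀ - κ Δθ₀` (`IsForcedSolution`). Averaging `w` in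
time against a smooth weight commutes with `u` and gives functions of `x` that lie in `H¹` and
satisfy a stationary weak equation. In that equation a nonlinear function of the solution may be
used as a test function, because Fourier partial sums approximate in `H¹`
(`renormalized_inequality`). Shifting the weight in time then gives a Gronwall-free comparison
argument (`IsForcedSolution.timeAvg_deriv_le`), and letting the weight shrink to a point yields
Lipschitz continuity (`IsForcedSolution.ae_exists_lipschitz`).

Dissipation: testing the equation with the time-averaged `w` itself bounds `κ ‖∇w‖²` at almost every
time by `∫ |∂_t w| |w| + ∫ |F| |w|`, and both terms are controlled by `C` and `T`. Weak-*
compactness of balls in `L^∞` does the rest.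

Energy: the Lipschitz bound in time is a bound on averages over sets, hence survives weak-* limits
(`TendstoWeakStar.ae_abs_sub_le`). The square of a bounded Lipschitz function is Lipschitz, and
bounded difference quotients have a bounded weak limit, which is the derivative
(`exists_hasWeakTimeDeriv`). -/

/-! ### Differential calculus on the torus -/

theorem isOpenQuotientMap_toTorus : IsOpenQuotientMap (toTorus (d := d)) :=
  IsOpenQuotientMap.piMap fun _ => QuotientAddGroup.isOpenQuotientMap_mk

theorem toTorus_add_smul_single (y : Fin d → ℝ) (i : Fin d) (h : ℝ) :
    toTorus (y + h • Pi.single i 1) = toTorus y + Pi.single i (h : UnitAddCircle) := by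
  ext j
  by_cases hj : j = i
  · subst hj; simp [toTorus]
  · simp [toTorus, hj]

theorem TorusContDiff.continuous {n : ℕ∞} {f : Torus d → ℝ} (hf : TorusContDiff n f) :
    Continuous f :=
  isOpenQuotientMap_toTorus.continuous_comp_iff.1 (ContDiff.continuous hf)

theorem TorusContDiff.of_le {n m : ℕ∞} {f : Torus d → ℝ} (hf : TorusContDiff n f) (h : m ≤ n) :
    TorusContDiff m f :=
  ContDiff.of_le hf (by exact_mod_cast h)

theorem TorusContDiff.of_top {n : ℕ∞} {f : Torus d → ℝ} (hf : TorusContDiff ⊤ f) :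
    TorusContDiff n f := hf.of_le le_top

theorem TorusContDiff.differentiable {f : Torus d → ℝ} (hf : TorusContDiff 1 f) :
    Differentiable ℝ (fun y => f (toTorus y)) :=
  ContDiff.differentiable hf (by norm_num)

theorem TorusContDiff.hasDerivAt_toTorus {f : Torus d → ℝ} (hf : TorusContDiff 1 f) (i : Fin d)
    (y : Fin d → ℝ) (h : ℝ) :
    HasDerivAt (fun h : ℝ => f (toTorus y + Pi.single i (h : UnitAddCircle)))
      (fderiv ℝ (fun y => f (toTorus y)) (y + h • Pi.single i 1) (Pi.single i 1)) h := by
  have h1 : HasDerivAt (fun h : ℝ => y + h • (Pi.single i 1 : Fin d → ℝ)) (Pi.single i 1) h := by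
    simpa using ((hasDerivAt_id h).smul_const (Pi.single i 1 : Fin d → ℝ)).const_add y
  have h2 := (hf.differentiable (y + h • Pi.single i 1)).hasFDerivAt.comp_hasDerivAt h h1
  simpa only [Function.comp_def, toTorus_add_smul_single] using h2

theorem partialDeriv_toTorus {f : Torus d → ℝ} (hf : TorusContDiff 1 f) (i : Fin d)
    (y : Fin d → ℝ) :
    partialDeriv i f (toTorus y) = fderiv ℝ (fun y => f (toTorus y)) y (Pi.single i 1) := by
  have h := (hf.hasDerivAt_toTorus i y 0).deriv
  rwa [zero_smul, add_zero] at h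

theorem TorusContDiff.hasDerivAt' {f : Torus d → ℝ} (hf : TorusContDiff 1 f) (i : Fin d)
    (x : Torus d) (h : ℝ) :
    HasDerivAt (fun h : ℝ => f (x + Pi.single i (h : UnitAddCircle)))
      (partialDeriv i f (x + Pi.single i (h : UnitAddCircle))) h := by
  obtain ⟨y, rfl⟩ := isOpenQuotientMap_toTorus.surjective x
  have := hf.hasDerivAt_toTorus i y h
  rwa [← toTorus_add_smul_single, partialDeriv_toTorus hf]

theorem TorusContDiff.hasDerivAt {f : Torus d → ℝ} (hf : TorusContDiff 1 f) (i : Fin d)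
    (x : Torus d) :
    HasDerivAt (fun h : ℝ => f (x + Pi.single i (h : UnitAddCircle))) (partialDeriv i f x) 0 := by
  simpa using hf.hasDerivAt' i x 0

theorem TorusContDiff.partialDeriv {n m : ℕ∞} {f : Torus d → ℝ} (hf : TorusContDiff n f)
    (h : m + 1 ≤ n) (i : Fin d) : TorusContDiff m (partialDeriv i f) := by
  have h1 : TorusContDiff 1 f := hf.of_le (le_trans (by simp) h)
  unfold TorusContDiff
  simp only [partialDeriv_toTorus h1]
  exact (ContDiff.fderiv_right hf (by exact_mod_cast h)).clm_apply contDiff_const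

theorem TorusContDiff.continuous_partialDeriv {f : Torus d → ℝ} (hf : TorusContDiff 1 f)
    (i : Fin d) : Continuous (AdvDiff.partialDeriv i f) :=
  (hf.partialDeriv (m := 0) (by simp) i).continuous

theorem TorusContDiff.mul {n : ℕ∞} {f g : Torus d → ℝ} (hf : TorusContDiff n f)
    (hg : TorusContDiff n g) : TorusContDiff n (fun x => f x * g x) := ContDiff.mul hf hg

theorem TorusContDiff.comp_left {n : ℕ∞} {f : Torus d → ℝ} {b : ℝ → ℝ} (hb : ContDiff ℝ n b)
    (hf : TorusContDiff n f) : TorusContDiff n (fun x => b (f x)) := ContDiff.comp hb hf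

theorem torusContDiff_const {n : ℕ∞} (c : ℝ) : TorusContDiff n (fun _ : Torus d => c) :=
  contDiff_const

theorem partialDeriv_mul {f g : Torus d → ℝ} (hf : TorusContDiff 1 f) (hg : TorusContDiff 1 g)
    (i : Fin d) (x : Torus d) :
    partialDeriv i (fun x => f x * g x) x = partialDeriv i f x * g x + f x * partialDeriv i g x := by
  have h := ((hf.hasDerivAt i x).mul (hg.hasDerivAt i x)).deriv
  simp only [QuotientAddGroup.mk_zero, Pi.single_zero, add_zero] at h
  exact h

theorem partialDeriv_comp {f : Torus d → ℝ} (hf : TorusContDiff 1 f) {b b' : ℝ → ℝ}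
    (hb : ∀ s, HasDerivAt b (b' s) s) (i : Fin d) (x : Torus d) :
    partialDeriv i (fun x => b (f x)) x = b' (f x) * partialDeriv i f x := by
  have h := hf.hasDerivAt i x
  have := HasDerivAt.comp (h₂ := b) (h₂' := b' (f x)) (0 : ℝ) (by simpa using hb (f x)) h
  exact this.deriv

theorem abs_le_supNorm {f : Torus d → ℝ} (hf : Continuous f) (x : Torus d) : |f x| ≤ supNorm f :=
  le_ciSup (isCompact_range hf.abs).bddAbove x

theorem supNorm_nonneg (f : Torus d → ℝ) : 0 ≤ supNorm f :=
  Real.iSup_nonneg fun _ => abs_nonneg _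

theorem memLp_of_continuous {E : Type*} [NormedAddCommGroup E] {f : Torus d → E}
    (hf : Continuous f) (p : ℝ≥0∞) : MemLp f p volume := by
  obtain ⟨C, hC⟩ := (isCompact_range hf.norm).bddAbove
  exact MemLp.of_bound hf.aestronglyMeasurable_of_compactSpace C
    (ae_of_all _ fun x => hC ⟨x, rfl⟩)

theorem integrable_of_continuous {f : Torus d → ℝ} (hf : Continuous f) : Integrable f volume :=
  memLp_one_iff_integrable.1 (memLp_of_continuous hf 1)

/-- Translation invariance makes `h ↦ ∫ f (x + h e_i)` constant; differentiate it under the integral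
at `h = 0`. -/
theorem integral_partialDeriv {f : Torus d → ℝ} (hf : TorusContDiff 1 f) (i : Fin d) :
    ∫ x, partialDeriv i f x = 0 := by
  have hc := hf.continuous_partialDeriv i
  have key := hasDerivAt_integral_of_dominated_loc_of_deriv_le (μ := (volume : Measure (Torus d)))
    (F := fun (h : ℝ) x => f (x + Pi.single i (h : UnitAddCircle)))
    (F' := fun (h : ℝ) x => partialDeriv i f (x + Pi.single i (h : UnitAddCircle)))
    (x₀ := 0) (s := univ) (bound := fun _ => supNorm (partialDeriv i f)) univ_mem
    (Eventually.of_forall fun h =>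
      (memLp_of_continuous (hf.continuous.comp (by fun_prop)) 1).1)
    (by simpa using integrable_of_continuous hf.continuous)
    (by simpa using (memLp_of_continuous hc 1).1)
    (ae_of_all _ fun x h _ => abs_le_supNorm hc _) (integrable_const _)
    (ae_of_all _ fun x h _ => hf.hasDerivAt' i x h)
  have h2 := key.2
  simp only [integral_add_right_eq_self (μ := (volume : Measure (Torus d))) f] at h2
  simpa using h2.unique (hasDerivAt_const 0 _)

theorem integral_mul_partialDeriv {f g : Torus d → ℝ} (hf : TorusContDiff 1 f)
    (hg : TorusContDiff 1 g) (i : Fin d) :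
    ∫ x, f x * partialDeriv i g x = -∫ x, partialDeriv i f x * g x := by
  have h := integral_partialDeriv (hf.mul hg) i
  simp only [partialDeriv_mul hf hg] at h
  have h' := integral_add
    (integrable_of_continuous ((hf.continuous_partialDeriv i).mul hg.continuous))
    (integrable_of_continuous (hf.continuous.mul (hg.continuous_partialDeriv i)))
  simp only [Pi.mul_apply] at h'
  rw [h'] at h
  linarith

/-! ### Fourier series and smooth approximation in `H¹` -/

theorem pi_haarAddCircle_eq_volume :
    Measure.pi (fun _ : Fin d => (AddCircle.haarAddCircle : Measure UnitAddCircle)) =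
      (volume : Measure (Torus d)) := by
  rw [volume_pi]
  congr 1
  ext1 i
  rw [AddCircle.volume_eq_smul_haarAddCircle]
  simp

theorem coeFn_Lp_sum {α ι E : Type*} [MeasurableSpace α] [NormedAddCommGroup E] {μ : Measure α}
    {p : ℝ≥0∞} (S : Finset ι) (f : ι → Lp E p μ) :
    ∀ᵐ x ∂μ, (∑ k ∈ S, f k : Lp E p μ) x = ∑ k ∈ S, f k x := by
  classical
  induction S using Finset.induction_on with
  | empty =>
    filter_upwards [Lp.coeFn_zero E p μ] with x hx
    simpa using hx
  | insert a S ha ih =>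
    rw [Finset.sum_insert ha]
    filter_upwards [ih, Lp.coeFn_add (f a) (∑ k ∈ S, f k)] with x h1 h2
    rw [h2, Pi.add_apply, h1, Finset.sum_insert ha]

/-- Mean-square convergence of Fourier series. The measure is an explicit variable so that the
statement survives the change of the ambient measure on the circle made inside the proof. -/
theorem tendsto_eLpNorm_fourier_pi {f : Torus d → ℂ} {μ : Measure (Torus d)}
    (hμ : μ = Measure.pi (fun _ : Fin d => (AddCircle.haarAddCircle : Measure UnitAddCircle)))
    (hf : MemLp f 2 μ) :
    Tendsto (fun S : Finset (Fin d → ℤ) => eLpNorm (fun x =>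
      ∑ k ∈ S, (∫ y, UnitAddTorus.mFourier (-k) y * f y ∂μ) * UnitAddTorus.mFourier k x - f x) 2 μ)
      atTop (𝓝 0) := by
  -- The Fourier theory is stated for the Haar measure as `volume`; this local instance makes `μ`
  -- that volume.
  let _ : MeasureSpace UnitAddCircle := ⟨AddCircle.haarAddCircle⟩
  change μ = volume at hμ
  subst hμ
  have h := UnitAddTorus.hasSum_mFourier_series_L2 (hf.toLp f)
  rw [HasSum, tendsto_iff_norm_sub_tendsto_zero] at h
  have hc : ∀ k, UnitAddTorus.mFourierCoeff (hf.toLp f) k =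
      ∫ y, UnitAddTorus.mFourier (-k) y * f y := fun k => by
    refine integral_congr_ae ?_
    filter_upwards [hf.coeFn_toLp] with x hx
    rw [hx, smul_eq_mul]
  simp only [SummationFilter.unconditional_filter, Lp.norm_def] at h
  rw [← ENNReal.toReal_zero, ENNReal.tendsto_toReal_iff (fun S => Lp.eLpNorm_ne_top _) (by simp)]
    at h
  refine h.congr fun S => eLpNorm_congr_ae ?_
  have h1 : ∀ᵐ x, ∀ k : Fin d → ℤ, UnitAddTorus.mFourierLp 2 k x = UnitAddTorus.mFourier k x :=
    ae_all_iff.2 fun k => UnitAddTorus.coeFn_mFourierLp 2 k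
  filter_upwards [hf.coeFn_toLp, Lp.coeFn_sub (∑ k ∈ S, UnitAddTorus.mFourierCoeff (hf.toLp f) k •
    UnitAddTorus.mFourierLp 2 k) (hf.toLp f), h1,
    coeFn_Lp_sum S (fun k => UnitAddTorus.mFourierCoeff (hf.toLp f) k •
    UnitAddTorus.mFourierLp 2 k), ae_all_iff.2 fun k : Fin d → ℤ => Lp.coeFn_smul
    (UnitAddTorus.mFourierCoeff (hf.toLp f) k) (UnitAddTorus.mFourierLp 2 k)]
    with x h2 h3 h1 h4 h5
  rw [h3, Pi.sub_apply, h2, h4]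
  simp only [h5, Pi.smul_apply, h1, smul_eq_mul]
  simp only [hc]

theorem tendsto_eLpNorm_fourier {f : Torus d → ℂ} (hf : MemLp f 2 volume) :
    Tendsto (fun S : Finset (Fin d → ℤ) => eLpNorm (fun x =>
      ∑ k ∈ S, (∫ y, UnitAddTorus.mFourier (-k) y * f y) * UnitAddTorus.mFourier k x - f x) 2 volume)
      atTop (𝓝 0) :=
  tendsto_eLpNorm_fourier_pi pi_haarAddCircle_eq_volume.symm hf

theorem mFourier_toTorus (k : Fin d → ℤ) (y : Fin d → ℝ) :
    UnitAddTorus.mFourier k (toTorus y) =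
      Complex.exp (2 * Real.pi * Complex.I * ∑ i, (k i : ℂ) * (y i : ℂ)) := by
  simp only [UnitAddTorus.mFourier, ContinuousMap.coe_mk, toTorus, fourier_coe_apply]
  rw [Finset.mul_sum, Complex.exp_sum]
  refine Finset.prod_congr rfl fun i _ => ?_
  congr 1
  simp
  ring

theorem contDiff_mFourier (k : Fin d → ℤ) :
    ContDiff ℝ ∞ (fun y : Fin d → ℝ => UnitAddTorus.mFourier k (toTorus y)) := by
  simp only [mFourier_toTorus]
  refine ContDiff.cexp (contDiff_const.mul (ContDiff.sum fun i _ => contDiff_const.mul ?_))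
  exact Complex.ofRealCLM.contDiff.comp (contDiff_apply ℝ ℝ i)

theorem hasDerivAt_mFourier (k : Fin d → ℤ) (i : Fin d) (x : Torus d) :
    HasDerivAt (fun h : ℝ => UnitAddTorus.mFourier k (x + Pi.single i (h : UnitAddCircle)))
      (2 * Real.pi * Complex.I * k i * UnitAddTorus.mFourier k x) 0 := by
  obtain ⟨y, rfl⟩ := isOpenQuotientMap_toTorus.surjective x
  simp only [← toTorus_add_smul_single, mFourier_toTorus]
  have h1 : ∀ h : ℝ, ∑ j, (k j : ℂ) * (((y + h • Pi.single i 1 : Fin d → ℝ) j : ℝ) : ℂ) =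
      ∑ j, (k j : ℂ) * (y j : ℂ) + k i * (h : ℂ) := fun h => by
    simp only [Pi.add_apply, Pi.smul_apply, smul_eq_mul, Complex.ofReal_add, mul_add,
      Finset.sum_add_distrib]
    congr 1
    rw [Finset.sum_eq_single i]
    · simp
    · intro j _ hj; simp [hj]
    · simp
  simp only [h1]
  have h2 : HasDerivAt (fun h : ℝ => 2 * Real.pi * Complex.I *
      (∑ j, (k j : ℂ) * (y j : ℂ) + k i * (h : ℂ))) (2 * Real.pi * Complex.I * (k i * 1)) 0 :=
    (((Complex.ofRealCLM.hasDerivAt (x := (0 : ℝ))).const_mul (k i : ℂ)).const_add _).const_mul _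
  have h3 := h2.cexp
  convert h3 using 1
  simp
  ring

/-- The real part of a trigonometric polynomial. -/
noncomputable def trigPoly (S : Finset (Fin d → ℤ)) (c : (Fin d → ℤ) → ℂ) (x : Torus d) : ℝ :=
  (∑ k ∈ S, c k * UnitAddTorus.mFourier k x).re

theorem torusContDiff_trigPoly (S : Finset (Fin d → ℤ)) (c : (Fin d → ℤ) → ℂ) :
    TorusContDiff ⊤ (trigPoly S c) :=
  Complex.reCLM.contDiff.comp
    (ContDiff.sum fun k _ => contDiff_const.mul (contDiff_mFourier k))

theorem partialDeriv_trigPoly (S : Finset (Fin d → ℤ)) (c : (Fin d → ℤ) → ℂ) (i : Fin d)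
    (x : Torus d) :
    partialDeriv i (trigPoly S c) x =
      trigPoly S (fun k => c k * (2 * Real.pi * Complex.I * k i)) x := by
  have h : HasDerivAt (fun h : ℝ => ∑ k ∈ S, c k * UnitAddTorus.mFourier k
      (x + Pi.single i (h : UnitAddCircle)))
      (∑ k ∈ S, c k * (2 * Real.pi * Complex.I * k i * UnitAddTorus.mFourier k x)) 0 :=
    HasDerivAt.fun_sum fun k _ => (hasDerivAt_mFourier k i x).const_mul (c k)
  have h2 := (Complex.reCLM.hasFDerivAt.comp_hasDerivAt (0 : ℝ) h).deriv
  simp only [trigPoly, mul_assoc] at h2 ⊢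
  exact h2

/-- Weak derivatives are tested on real functions only, so Fourier coefficients are split into real
and imaginary parts. The minus sign comes from `Re (i e_k) = -Im e_k`. -/
theorem integral_mFourier_mul_ofReal (k : Fin d → ℤ) {v : Torus d → ℝ} (hv : Integrable v) :
    ∫ x, UnitAddTorus.mFourier k x * (v x : ℂ) =
      ((∫ x, v x * trigPoly {k} 1 x : ℝ) : ℂ) -
        ((∫ x, v x * trigPoly {k} (fun _ => Complex.I) x : ℝ) : ℂ) * Complex.I := by
  have hi : Integrable (fun x => UnitAddTorus.mFourier k x * (v x : ℂ)) :=
    hv.ofReal.bdd_mul (c := 1) (UnitAddTorus.mFourier k).continuous.aestronglyMeasurable_of_compactSpace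
      (ae_of_all _ fun x => ((UnitAddTorus.mFourier k).norm_coe_le_norm x).trans_eq
        UnitAddTorus.mFourier_norm)
  rw [← integral_re_add_im hi, sub_eq_add_neg]
  congr 1
  · congr 2; ext x; simp [trigPoly, mul_comm]
  · rw [← neg_mul, ← Complex.ofReal_neg, ← integral_neg]
    congr 3; ext x; simp [trigPoly, mul_comm]

/-- `g` is the weak `i`-th partial derivative of `v` on the torus. -/
def HasWeakPartial (i : Fin d) (v g : Torus d → ℝ) : Prop :=
  ∀ ψ : Torus d → ℝ, TorusContDiff ⊤ ψ → ∫ x, v x * partialDeriv i ψ x = -∫ x, g x * ψ x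

/-- Differentiation multiplies the `k`-th coefficient by `2πi k_i`: on the real level `∂_i`
exchanges the real and imaginary parts of `e_{-k}` up to the factor `±2π k_i`. -/
theorem HasWeakPartial.integral_mFourier {i : Fin d} {v g : Torus d → ℝ}
    (h : HasWeakPartial i v g) (hv : Integrable v) (hg : Integrable g) (k : Fin d → ℤ) :
    ∫ x, UnitAddTorus.mFourier (-k) x * (g x : ℂ) =
      (∫ x, UnitAddTorus.mFourier (-k) x * (v x : ℂ)) * (2 * Real.pi * Complex.I * k i) := by
  have h1 := h _ (torusContDiff_trigPoly {-k} 1)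
  have h2 := h _ (torusContDiff_trigPoly {-k} fun _ => Complex.I)
  have e1 : ∀ x, partialDeriv i (trigPoly {-k} 1) x =
      -(2 * Real.pi * k i) * trigPoly {-k} (fun _ => Complex.I) x := fun x => by
    rw [partialDeriv_trigPoly]; simp [trigPoly]
  have e2 : ∀ x, partialDeriv i (trigPoly {-k} fun _ => Complex.I) x =
      (2 * Real.pi * k i) * trigPoly {-k} 1 x := fun x => by
    rw [partialDeriv_trigPoly]; simp [trigPoly]
  simp only [e1, e2, mul_left_comm (v _), integral_const_mul] at h1 h2
  rw [integral_mFourier_mul_ofReal _ hv, integral_mFourier_mul_ofReal _ hg]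
  rw [eq_neg_iff_add_eq_zero, add_comm, ← eq_neg_iff_add_eq_zero] at h1 h2
  rw [h1, h2]
  push_cast
  ring_nf
  simp

/-- Fourier partial sums commute with weak derivatives, so the same trigonometric polynomials
approximate `v` and all of its weak partials in `L²`. -/
theorem exists_smooth_approx {v : Torus d → ℝ} {g : Fin d → Torus d → ℝ}
    (hv : MemLp v 2 volume) (hg : ∀ i, MemLp (g i) 2 volume)
    (h : ∀ i, HasWeakPartial i v (g i)) :
    ∃ ψ : ℕ → Torus d → ℝ, (∀ n, TorusContDiff ⊤ (ψ n)) ∧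
      Tendsto (fun n => eLpNorm (fun x => ψ n x - v x) 2 volume) atTop (𝓝 0) ∧
      ∀ i, Tendsto (fun n => eLpNorm (fun x => partialDeriv i (ψ n) x - g i x) 2 volume)
        atTop (𝓝 0) := by
  obtain ⟨S, hS⟩ := exists_seq_tendsto (atTop : Filter (Finset (Fin d → ℤ)))
  have key : ∀ f : Torus d → ℝ, MemLp f 2 volume → Tendsto (fun n => eLpNorm (fun x =>
      trigPoly (S n) (fun k => ∫ y, UnitAddTorus.mFourier (-k) y * (f y : ℂ)) x - f x) 2 volume)
      atTop (𝓝 0) := fun f hf => by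
    refine tendsto_of_tendsto_of_tendsto_of_le_of_le tendsto_const_nhds
      ((tendsto_eLpNorm_fourier hf.ofReal).comp hS) (fun _ => zero_le) fun n => ?_
    refine eLpNorm_mono fun x => ?_
    refine le_trans (le_of_eq ?_) (Complex.abs_re_le_norm _)
    simp [trigPoly]
  refine ⟨fun n => trigPoly (S n) (fun k => ∫ y, UnitAddTorus.mFourier (-k) y * (v y : ℂ)),
    fun n => torusContDiff_trigPoly _ _, key v hv, fun i => ?_⟩
  refine (key (g i) (hg i)).congr fun n => ?_
  simp only [partialDeriv_trigPoly, (h i).integral_mFourier (hv.integrable one_le_two)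
    ((hg i).integrable one_le_two)]

/-! ### Passing to the limit in `L²` pairings -/

section L2

variable {α : Type*} [MeasurableSpace α] {μ : Measure α}

theorem tendsto_integral_mul_of_L2 {a c : ℕ → α → ℝ} {a₀ c₀ : α → ℝ}
    (ha : ∀ n, MemLp (a n) 2 μ) (ha₀ : MemLp a₀ 2 μ) (hc : ∀ n, MemLp (c n) 2 μ)
    (hc₀ : MemLp c₀ 2 μ)
    (hta : Tendsto (fun n => eLpNorm (fun x => a n x - a₀ x) 2 μ) atTop (𝓝 0))
    (htc : Tendsto (fun n => eLpNorm (fun x => c n x - c₀ x) 2 μ) atTop (𝓝 0)) :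
    Tendsto (fun n => ∫ x, a n x * c n x ∂μ) atTop (𝓝 (∫ x, a₀ x * c₀ x ∂μ)) := by
  have h1 := (Lp.tendsto_Lp_iff_tendsto_eLpNorm'' a ha a₀ ha₀).2 hta
  have h2 := (Lp.tendsto_Lp_iff_tendsto_eLpNorm'' c hc c₀ hc₀).2 htc
  have h3 : ∀ {f g : α → ℝ} (hf : MemLp f 2 μ) (hg : MemLp g 2 μ),
      inner ℝ (hf.toLp f) (hg.toLp g) = ∫ x, f x * g x ∂μ := fun hf hg => by
    rw [L2.inner_def]
    refine integral_congr_ae ?_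
    filter_upwards [hf.coeFn_toLp, hg.coeFn_toLp] with x hx hy
    rw [hx, hy]
    simp [mul_comm]
  simpa only [h3] using h1.inner (𝕜 := ℝ) h2

theorem tendsto_eLpNorm_bdd_mul {m e : ℕ → α → ℝ} {C : ℝ} (hm : ∀ n, ∀ᵐ x ∂μ, |m n x| ≤ C)
    (he : Tendsto (fun n => eLpNorm (e n) 2 μ) atTop (𝓝 0)) :
    Tendsto (fun n => eLpNorm (fun x => m n x * e n x) 2 μ) atTop (𝓝 0) := by
  refine tendsto_of_tendsto_of_tendsto_of_le_of_le (h := fun n => ENNReal.ofReal C * eLpNorm (e n) 2 μ)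
    tendsto_const_nhds ?_ (fun _ => zero_le) fun n => ?_
  · simpa using ENNReal.Tendsto.const_mul (a := ENNReal.ofReal C) he (Or.inr ENNReal.ofReal_ne_top)
  · refine eLpNorm_le_mul_eLpNorm_of_ae_le_mul ?_ 2
    filter_upwards [hm n] with x hx
    rw [norm_mul]
    exact mul_le_mul_of_nonneg_right hx (norm_nonneg _)

end L2

theorem memLp_bdd_mul {α : Type*} [MeasurableSpace α] {μ : Measure α} {m e : α → ℝ} {C : ℝ}
    {p : ℝ≥0∞} (hm : AEStronglyMeasurable m μ) (hC : ∀ᵐ x ∂μ, |m x| ≤ C) (he : MemLp e p μ) :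
    MemLp (fun x => m x * e x) p μ := by
  refine MemLp.of_le_mul (c := C) he (hm.mul he.1) ?_
  filter_upwards [hC] with x hx
  rw [norm_mul]
  exact mul_le_mul_of_nonneg_right hx (norm_nonneg _)

theorem exists_primitive {b : ℝ → ℝ} (hb : ContDiff ℝ ∞ b) :
    ∃ B : ℝ → ℝ, ContDiff ℝ ∞ B ∧ B 0 = 0 ∧ ∀ s, HasDerivAt B (b s) s := by
  have h : ∀ s, HasDerivAt (fun s => ∫ r in (0 : ℝ)..s, b r) (b s) s := fun s =>
    intervalIntegral.integral_hasDerivAt_right (hb.continuous.intervalIntegrable _ _)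
      (hb.continuous.stronglyMeasurableAtFilter _ _) hb.continuous.continuousAt
  refine ⟨fun s => ∫ r in (0 : ℝ)..s, b r, ?_, by simp, h⟩
  rw [contDiff_infty_iff_deriv]
  refine ⟨fun s => (h s).differentiableAt, ?_⟩
  rwa [show deriv (fun s => ∫ r in (0 : ℝ)..s, b r) = b from funext fun s => (h s).deriv]

/-! ### Nonlinear test functions in the stationary equation -/

/-- Formally, test `z + div (u v) = κ Δv + f` with `b(v)`. The transport term is `∫ u · ∇P(v)` with
`P' = s b'(s)`, hence zero, and the diffusion term is at least `κ m ∫ |∇v|²`. Since `v` is only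
`H¹`, the test function is `b(ψ_n)` with `ψ_n` smooth and the errors are shown to vanish. -/
theorem renormalized_inequality {z v f : Torus d → ℝ} {g u : Fin d → Torus d → ℝ} {U κ m L : ℝ}
    (hκ : 0 ≤ κ) (hz : MemLp z 2 volume) (hv : MemLp v 2 volume) (hf : MemLp f 2 volume)
    (hg : ∀ i, MemLp (g i) 2 volume) (hu : ∀ i, AEStronglyMeasurable (u i) volume)
    (hU : ∀ i, ∀ᵐ x, |u i x| ≤ U)
    (hdiv : ∀ ψ, TorusContDiff ⊤ ψ → ∑ i, (∫ x, u i x * partialDeriv i ψ x) = 0)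
    (hvg : ∀ i, HasWeakPartial i v (g i))
    (heq : ∀ ψ, TorusContDiff ⊤ ψ → ∫ x, z x * ψ x =
      ∑ i, (∫ x, v x * u i x * partialDeriv i ψ x) -
        κ * ∑ i, (∫ x, g i x * partialDeriv i ψ x) + ∫ x, f x * ψ x)
    {b b' : ℝ → ℝ} (hb : ContDiff ℝ ∞ b) (hb' : ∀ s, HasDerivAt b (b' s) s)
    (hm₀ : 0 ≤ m) (hm : ∀ s, m ≤ b' s) (hL : ∀ s, b' s ≤ L) :
    (∫ x, z x * b (v x)) + κ * (m * ∑ i, ∫ x, g i x * g i x) ≤ ∫ x, f x * b (v x) := by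
  obtain ⟨ψ, hψ, hψv, hψg⟩ := exists_smooth_approx hv hg hvg
  have hb'c : Continuous b' := by
    rw [show b' = deriv b from funext fun s => (hb' s).deriv.symm]
    exact hb.continuous_deriv (by simp)
  have hbL : ∀ s, |b' s| ≤ L := fun s => abs_le.2 ⟨by linarith [hm s, hL s], hL s⟩
  have hL0 : 0 ≤ L := (abs_nonneg _).trans (hbL 0)
  have hlip : ∀ s r, |b s - b r| ≤ L * |s - r| := fun s r => by
    have := Convex.norm_image_sub_le_of_norm_hasDerivWithin_le (f := b) (f' := b') (C := L)
      (s := univ) (x := r) (y := s) (fun x _ => (hb' x).hasDerivWithinAt) (fun x _ => hbL x)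
      convex_univ trivial trivial
    simpa using this
  have hψ1 : ∀ n, TorusContDiff 1 (ψ n) := fun n => (hψ n).of_top
  have hψm : ∀ n, MemLp (ψ n) 2 volume := fun n => memLp_of_continuous (hψ n).continuous 2
  have hdm : ∀ n i, MemLp (partialDeriv i (ψ n)) 2 volume := fun n i =>
    memLp_of_continuous ((hψ1 n).continuous_partialDeriv i) 2
  have hbψ : ∀ n, MemLp (fun x => b (ψ n x)) 2 volume := fun n =>
    memLp_of_continuous (hb.continuous.comp (hψ n).continuous) 2
  have hbψc : ∀ n, Continuous (fun x => b' (ψ n x)) := fun n => hb'c.comp (hψ n).continuous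
  have hbv : MemLp (fun x => b (v x)) 2 volume := by
    refine MemLp.of_le_mul (c := 1) ((hv.norm.const_mul L).add (memLp_const (|b 0|)))
      (hb.continuous.comp_aestronglyMeasurable hv.1) (ae_of_all _ fun x => ?_)
    have h1 := hlip (v x) 0
    have h2 := abs_sub_abs_le_abs_sub (b (v x)) (b 0)
    simp only [sub_zero, Real.norm_eq_abs, one_mul, Pi.add_apply] at h1 h2 ⊢
    exact le_trans (by linarith) (le_abs_self _)
  have htb : Tendsto (fun n => eLpNorm (fun x => b (ψ n x) - b (v x)) 2 volume) atTop (𝓝 0) := by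
    have := ENNReal.Tendsto.const_mul (a := ENNReal.ofReal L) hψv (Or.inr ENNReal.ofReal_ne_top)
    rw [mul_zero] at this
    refine tendsto_of_tendsto_of_tendsto_of_le_of_le tendsto_const_nhds this
      (fun _ => zero_le) fun n => ?_
    exact eLpNorm_le_mul_eLpNorm_of_ae_le_mul (ae_of_all _ fun x => hlip _ _) 2
  have t0 : ∀ {a : Torus d → ℝ}, Tendsto (fun _ : ℕ => eLpNorm (fun x => a x - a x) 2 volume)
      atTop (𝓝 0) := by simp
  have tz := tendsto_integral_mul_of_L2 (fun _ => hz) hz hbψ hbv t0 htb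
  have tf := tendsto_integral_mul_of_L2 (fun _ => hf) hf hbψ hbv t0 htb
  have tg := fun i => tendsto_integral_mul_of_L2 (hdm · i) (hg i) (hdm · i) (hg i) (hψg i) (hψg i)
  have mu : ∀ n i, AEStronglyMeasurable (fun x => u i x * b' (ψ n x)) volume := fun n i =>
    (hu i).mul (hbψc n).aestronglyMeasurable_of_compactSpace
  have bu : ∀ n i, ∀ᵐ x, |u i x * b' (ψ n x)| ≤ U * L := fun n i => by
    filter_upwards [hU i] with x hx
    rw [abs_mul]
    exact mul_le_mul hx (hbL _) (abs_nonneg _) ((abs_nonneg _).trans hx)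
  have mg : ∀ n, AEStronglyMeasurable (fun x => b' (ψ n x)) volume := fun n =>
    (hbψc n).aestronglyMeasurable_of_compactSpace
  have hψv' : Tendsto (fun n => eLpNorm (fun x => v x - ψ n x) 2 volume) atTop (𝓝 0) :=
    hψv.congr fun n => eLpNorm_congr_norm_ae (ae_of_all _ fun x => norm_sub_rev _ _)
  -- `r1` and `r2` are the errors made by replacing `v` by `ψ_n` in the transport and diffusion
  -- terms. Each is a bounded factor times an `L²`-null sequence, paired with an `L²`-convergent
  -- one.
  have r1 : ∀ i, Tendsto (fun n => ∫ x, (u i x * b' (ψ n x)) * (v x - ψ n x) *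
      partialDeriv i (ψ n) x) atTop (𝓝 0) := fun i => by
    have := tendsto_integral_mul_of_L2
      (fun n => memLp_bdd_mul (mu n i) (bu n i) (hv.sub (hψm n))) (MemLp.zero' (p := 2))
      (hdm · i) (hg i) (by simpa using tendsto_eLpNorm_bdd_mul (bu · i) hψv') (hψg i)
    simpa using this
  have r2 : ∀ i, Tendsto (fun n => ∫ x, b' (ψ n x) * (partialDeriv i (ψ n) x - g i x) *
      partialDeriv i (ψ n) x) atTop (𝓝 0) := fun i => by
    have := tendsto_integral_mul_of_L2
      (fun n => memLp_bdd_mul (mg n) (ae_of_all _ fun x => hbL _) ((hdm n i).sub (hg i)))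
      (MemLp.zero' (p := 2)) (hdm · i) (hg i)
      (by simpa using tendsto_eLpNorm_bdd_mul (fun n => ae_of_all _ fun x => hbL _) (hψg i))
      (hψg i)
    simpa using this
  obtain ⟨B, hB, -, hB'⟩ := exists_primitive hb
  -- `s b(s) - B(s)` is the primitive of `s b'(s)`, so the divergence-free condition tested on its
  -- composition with `ψ_n` removes the smooth transport term.
  have hP : ∀ s, HasDerivAt (fun s => s * b s - B s) (s * b' s) s := fun s => by
    have := ((hasDerivAt_id s).mul (hb' s)).sub (hB' s)
    simp only [id, one_mul, add_sub_cancel_left] at this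
    exact this
  have hPs : ContDiff ℝ ∞ (fun s => s * b s - B s) := (contDiff_id.mul hb).sub hB
  have tl := tz.add
    (((tendsto_finsetSum Finset.univ fun i _ => tg i).const_mul m).const_mul κ)
  have tr := (tf.add (tendsto_finsetSum Finset.univ fun i _ => r1 i)).add
    ((tendsto_finsetSum Finset.univ fun i _ => r2 i).const_mul κ)
  simp only [Finset.sum_const_zero, mul_zero, add_zero] at tr
  refine le_of_tendsto_of_tendsto' tl tr fun n => ?_
  have e1 := heq _ (TorusContDiff.comp_left hb (hψ n))
  have e2 := hdiv _ (TorusContDiff.comp_left hPs (hψ n))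
  simp only [partialDeriv_comp (hψ1 n) hb', partialDeriv_comp (hψ1 n) hP] at e1 e2
  have i2 : ∀ {a c : Torus d → ℝ}, MemLp a 2 volume → MemLp c 2 volume →
      Integrable (fun x => a x * c x) volume := fun ha hc => ha.integrable_mul hc
  have s1 : ∀ i, ∫ x, (u i x * b' (ψ n x)) * (v x - ψ n x) * partialDeriv i (ψ n) x =
      (∫ x, v x * u i x * (b' (ψ n x) * partialDeriv i (ψ n) x)) -
      ∫ x, u i x * (ψ n x * b' (ψ n x) * partialDeriv i (ψ n) x) := fun i => by
    rw [← integral_sub]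
    · congr 1; ext x; ring
    · exact (i2 (memLp_bdd_mul (mu n i) (bu n i) hv) (hdm n i)).congr
        (ae_of_all _ fun x => by ring)
    · exact (i2 (memLp_bdd_mul (mu n i) (bu n i) (hψm n)) (hdm n i)).congr
        (ae_of_all _ fun x => by ring)
  have s2 : ∀ i, ∫ x, b' (ψ n x) * (partialDeriv i (ψ n) x - g i x) * partialDeriv i (ψ n) x =
      (∫ x, b' (ψ n x) * (partialDeriv i (ψ n) x * partialDeriv i (ψ n) x)) -
      ∫ x, g i x * (b' (ψ n x) * partialDeriv i (ψ n) x) := fun i => by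
    rw [← integral_sub]
    · congr 1; ext x; ring
    · exact (i2 (memLp_bdd_mul (mg n) (ae_of_all _ fun x => hbL _) (hdm n i)) (hdm n i)).congr
        (ae_of_all _ fun x => by ring)
    · exact (i2 (memLp_bdd_mul (mg n) (ae_of_all _ fun x => hbL _) (hg i)) (hdm n i)).congr
        (ae_of_all _ fun x => by ring)
  have s3 : ∀ i, m * ∫ x, partialDeriv i (ψ n) x * partialDeriv i (ψ n) x ≤
      ∫ x, b' (ψ n x) * (partialDeriv i (ψ n) x * partialDeriv i (ψ n) x) := fun i => by
    rw [← integral_const_mul]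
    refine integral_mono ((i2 (hdm n i) (hdm n i)).const_mul m) ?_ fun x => ?_
    · exact (i2 (memLp_bdd_mul (mg n) (ae_of_all _ fun x => hbL _) (hdm n i)) (hdm n i)).congr
        (ae_of_all _ fun x => by ring)
    · exact mul_le_mul_of_nonneg_right (hm _) (mul_self_nonneg _)
  have s4 := mul_le_mul_of_nonneg_left (Finset.sum_le_sum fun i (_ : i ∈ Finset.univ) => s3 i) hκ
  simp only [s1, s2, Finset.sum_sub_distrib, e2, sub_zero]
  rw [mul_sub]
  rw [← Finset.mul_sum] at s4
  linarith

/-! ### Weighted averages in time -/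

/-- Cauchy–Schwarz against the constant `1`, read off from the discriminant of the nonnegative
quadratic `c ↦ ∫ (f - c)²`. -/
theorem sq_integral_le {α : Type*} [MeasurableSpace α] {μ : Measure α} [IsFiniteMeasure μ]
    {f : α → ℝ} (hf : MemLp f 2 μ) : (∫ x, f x ∂μ) ^ 2 ≤ μ.real univ * ∫ x, f x ^ 2 ∂μ := by
  have h1 := hf.integrable one_le_two
  have h2 := hf.integrable_sq
  have key : ∀ c : ℝ, 0 ≤ μ.real univ * (c * c) + (-2 * ∫ x, f x ∂μ) * c + ∫ x, f x ^ 2 ∂μ := by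
    intro c
    have h3 : 0 ≤ ∫ x, (f x - c) ^ 2 ∂μ := integral_nonneg fun x => sq_nonneg _
    have h4 : ∫ x, (f x - c) ^ 2 ∂μ = ∫ x, (f x ^ 2 - (2 * c) * f x + c * c) ∂μ := by
      congr 1; ext x; ring
    have h5 : Integrable (fun x => f x ^ 2 - (2 * c) * f x) μ := h2.sub (h1.const_mul _)
    rw [h4, integral_add h5 (integrable_const _),
      integral_sub h2 (h1.const_mul _), integral_const_mul, integral_const, smul_eq_mul] at h3
    linarith
  have := discrim_le_zero key
  rw [discrim] at this
  nlinarith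

/-- The weighted time average of `w` over `(0, T)`. -/
noncomputable def timeAvg (T : ℝ) (ζ : ℝ → ℝ) (w : ℝ × Torus d → ℝ) (x : Torus d) : ℝ :=
  ∫ s, ζ s * w (s, x) ∂(timeMeasure T)

section TimeAvg

variable {T M : ℝ} {w : ℝ × Torus d → ℝ} {ζ : ℝ → ℝ}

theorem measurable_timeAvg (hζ : Continuous ζ) (hw : Measurable w) :
    Measurable (timeAvg T ζ w) :=
  (StronglyMeasurable.integral_prod_left' (μ := timeMeasure T)
    (f := fun p : ℝ × Torus d => ζ p.1 * w p)
    ((hζ.measurable.comp measurable_fst).mul hw).stronglyMeasurable).measurable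

theorem integrable_timeMeasure (hζ : Continuous ζ) : Integrable ζ (timeMeasure T) :=
  (hζ.integrableOn_Icc (a := 0) (b := T)).mono_set Ioo_subset_Icc_self

theorem integrable_mul_slice (hζ : Continuous ζ) (hw : Measurable w) (hM : ∀ p, |w p| ≤ M)
    (x : Torus d) : Integrable (fun s => ζ s * w (s, x)) (timeMeasure T) :=
  (integrable_timeMeasure hζ).mul_bdd (c := M) (hw.comp (by fun_prop)).aestronglyMeasurable
    (ae_of_all _ fun s => hM _)

theorem abs_timeAvg_le {K : ℝ} (hT : 0 ≤ T) (hK : ∀ s, |ζ s| ≤ K) (hM : ∀ p, |w p| ≤ M)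
    (x : Torus d) : |timeAvg T ζ w x| ≤ K * M * T := by
  have := norm_integral_le_of_norm_le_const (μ := timeMeasure T) (f := fun s => ζ s * w (s, x))
    (C := K * M) (ae_of_all _ fun s => by
      rw [norm_mul]
      exact mul_le_mul (hK s) (hM _) (norm_nonneg _) ((abs_nonneg _).trans (hK s)))
  simpa [timeAvg, hT] using this

theorem memLp_timeAvg_of_bdd {K : ℝ} (hT : 0 ≤ T) (hζ : Continuous ζ) (hK : ∀ s, |ζ s| ≤ K)
    (hw : Measurable w) (hM : ∀ p, |w p| ≤ M) (p : ℝ≥0∞) : MemLp (timeAvg T ζ w) p volume :=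
  MemLp.of_bound (measurable_timeAvg hζ hw).aestronglyMeasurable (K * M * T)
    (ae_of_all _ fun x => abs_timeAvg_le hT hK hM x)

theorem memLp_timeAvg {K : ℝ} (hζ : Continuous ζ) (hK : ∀ s, |ζ s| ≤ K)
    (hw : Measurable w) (hw2 : MemLp w 2 (spaceTimeMeasure d T)) :
    MemLp (timeAvg T ζ w) 2 volume := by
  have hm := (measurable_timeAvg (T := T) hζ hw).aestronglyMeasurable (μ := volume)
  have h1 : MemLp (fun p : ℝ × Torus d => ζ p.1 * w p) 2 (spaceTimeMeasure d T) :=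
    memLp_bdd_mul (hζ.measurable.comp measurable_fst).aestronglyMeasurable
      (ae_of_all _ fun p => hK _) hw2
  have h2 := h1.integrable_sq
  refine (memLp_two_iff_integrable_sq hm).2 ?_
  refine Integrable.mono' (h2.integral_prod_right.const_mul ((timeMeasure T).real univ))
    (hm.pow 2) ?_
  filter_upwards [h2.prod_left_ae] with x hx
  rw [Real.norm_of_nonneg (sq_nonneg _)]
  refine sq_integral_le ((memLp_two_iff_integrable_sq ?_).2 hx)
  exact (hζ.measurable.mul (hw.comp (by fun_prop))).aestronglyMeasurable

/-- The time regularity comes entirely from the shifted weight: `w` need only be bounded and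
measurable. -/
theorem hasDerivAt_timeAvg {ζ' : ℝ → ℝ} {K : ℝ} (hζ : Continuous ζ) (hζ'c : Continuous ζ')
    (hζ' : ∀ s, HasDerivAt ζ (ζ' s) s) (hK : ∀ s, |ζ' s| ≤ K) (hw : Measurable w)
    (hM : ∀ p, |w p| ≤ M) (x : Torus d) (t : ℝ) :
    HasDerivAt (fun t => timeAvg T (fun s => ζ (s - t)) w x)
      (-timeAvg T (fun s => ζ' (s - t)) w x) t := by
  have key := hasDerivAt_integral_of_dominated_loc_of_deriv_le (μ := timeMeasure T)
    (F := fun t s => ζ (s - t) * w (s, x)) (F' := fun t s => -ζ' (s - t) * w (s, x))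
    (x₀ := t) (s := univ) (bound := fun _ => K * M) univ_mem
    (Eventually.of_forall fun t =>
      (integrable_mul_slice (hζ.comp (by fun_prop)) hw hM x).1)
    (integrable_mul_slice (hζ.comp (by fun_prop)) hw hM x)
    (integrable_mul_slice (hζ'c.comp (by fun_prop)).neg hw hM x).1
    (ae_of_all _ fun s t _ => by
      rw [norm_mul, norm_neg]
      exact mul_le_mul (hK _) (hM _) (norm_nonneg _) ((abs_nonneg _).trans (hK 0)))
    (integrable_const _)
    (ae_of_all _ fun s t _ => by
      have h1 : HasDerivAt (fun t => s - t) (-1) t := by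
        simpa using (hasDerivAt_id t).const_sub s
      have h2 := (hζ' (s - t)).comp t h1
      simpa using h2.mul_const (w (s, x)))
  have h := key.2
  simp only [neg_mul, integral_neg] at h
  exact h

end TimeAvg

/-! ### Forced solutions with zero initial value, and their maximum principle -/

/-- The evolution `∂_t w + u · ∇w - κ Δw = -F` on `(0, T)`, with zero initial value and spatial
gradient `G`, integrated in time against test functions. -/
structure IsForcedSolution (T κ C M U : ℝ) (u : Fin d → Torus d → ℝ) (F : Torus d → ℝ)
    (w : ℝ × Torus d → ℝ) (G : Fin d → ℝ × Torus d → ℝ) : Prop where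
  measurable : Measurable w
  bdd : ∀ p, |w p| ≤ M
  grad_measurable : ∀ i, Measurable (G i)
  grad_memLp : ∀ i, MemLp (G i) 2 (spaceTimeMeasure d T)
  forcing_meas : AEStronglyMeasurable F volume
  forcing_bdd : ∀ᵐ x, |F x| ≤ C
  drift_meas : ∀ i, AEStronglyMeasurable (u i) volume
  drift_bdd : ∀ i, ∀ᵐ x, |u i x| ≤ U
  divFree : ∀ ψ, TorusContDiff ⊤ ψ → ∑ i, (∫ x, u i x * partialDeriv i ψ x) = 0
  hasGrad : ∀ ζ, ContDiff ℝ ∞ ζ → HasCompactSupport ζ → ∀ i,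
    HasWeakPartial i (timeAvg T ζ w) (timeAvg T ζ (G i))
  equation : ∀ ζ, ContDiff ℝ ∞ ζ → HasCompactSupport ζ → tsupport ζ ⊆ Iio T →
    ∀ ψ, TorusContDiff ⊤ ψ →
      (∫ x, timeAvg T (deriv ζ) w x * ψ x) +
        (∑ i, (∫ x, timeAvg T ζ w x * u i x * partialDeriv i ψ x) -
          κ * ∑ i, ∫ x, timeAvg T ζ (G i) x * partialDeriv i ψ x) =
      (∫ s, ζ s ∂(timeMeasure T)) * ∫ x, F x * ψ x

theorem timeAvg_neg (T : ℝ) (ζ : ℝ → ℝ) (w : ℝ × Torus d → ℝ) :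
    timeAvg T ζ (fun p => -w p) = fun x => -timeAvg T ζ w x := by
  ext x
  simp only [timeAvg, mul_neg, integral_neg]

theorem IsForcedSolution.neg {T κ C M U : ℝ} {u : Fin d → Torus d → ℝ} {F : Torus d → ℝ}
    {w : ℝ × Torus d → ℝ} {G : Fin d → ℝ × Torus d → ℝ}
    (h : IsForcedSolution T κ C M U u F w G) :
    IsForcedSolution T κ C M U u (fun x => -F x) (fun p => -w p) (fun i p => -G i p) where
  measurable := h.measurable.neg
  bdd p := by rw [abs_neg]; exact h.bdd p
  grad_measurable i := (h.grad_measurable i).neg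
  grad_memLp i := (h.grad_memLp i).neg
  forcing_meas := h.forcing_meas.neg
  forcing_bdd := by simpa only [abs_neg] using h.forcing_bdd
  drift_meas := h.drift_meas
  drift_bdd := h.drift_bdd
  divFree := h.divFree
  hasGrad ζ hζ hc i ψ hψ := by
    have := h.hasGrad ζ hζ hc i ψ hψ
    simp only [timeAvg_neg, neg_mul, integral_neg, this]
  equation ζ hζ hc hs ψ hψ := by
    have := h.equation ζ hζ hc hs ψ hψ
    simp only [timeAvg_neg, neg_mul, integral_neg, Finset.sum_neg_distrib]
    linarith

theorem exists_deriv_smoothTransition_le : ∃ L, ∀ s, deriv Real.smoothTransition s ≤ L := by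
  have hc : Continuous (deriv Real.smoothTransition) :=
    (Real.smoothTransition.contDiff (n := 1)).continuous_deriv le_rfl
  have hs : HasCompactSupport (deriv Real.smoothTransition) := by
    refine HasCompactSupport.intro (isCompact_Icc (a := (0 : ℝ)) (b := 1)) fun x hx => ?_
    rw [mem_Icc, not_and_or, not_le, not_le] at hx
    rcases hx with hx | hx
    · have : Real.smoothTransition =ᶠ[𝓝 x] fun _ => 0 := by
        filter_upwards [Iio_mem_nhds hx] with y hy
        exact Real.smoothTransition.zero_of_nonpos (le_of_lt hy)
      rw [this.deriv_eq]; simp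
    · have : Real.smoothTransition =ᶠ[𝓝 x] fun _ => 1 := by
        filter_upwards [Ioi_mem_nhds hx] with y hy
        exact Real.smoothTransition.one_of_one_le (le_of_lt hy)
      rw [this.deriv_eq]; simp
  obtain ⟨L, hL⟩ := hs.exists_bound_of_continuous hc
  exact ⟨L, fun s => (le_abs_self _).trans (hL s)⟩

/-- A smooth substitute for the positive part: its integral vanishes only if the argument is
nonpositive almost everywhere, and its derivative is smooth, bounded and nondecreasing, hence an
admissible `b`. -/
theorem exists_smoothTransition_primitive :
    ∃ B : ℝ → ℝ, Continuous B ∧ (∀ s, HasDerivAt B (Real.smoothTransition s) s) ∧ (∀ s, 0 ≤ B s) ∧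
      B 0 = 0 ∧ ∀ s, B s = 0 → s ≤ 0 := by
  obtain ⟨B, hBs, hB0, hB⟩ := exists_primitive (b := Real.smoothTransition)
    Real.smoothTransition.contDiff
  have hmono : Monotone B := monotone_of_deriv_nonneg (hBs.differentiable (by simp)) fun s => by
    rw [(hB s).deriv]; exact Real.smoothTransition.nonneg s
  have hanti : AntitoneOn B (Iic 0) := by
    refine antitoneOn_of_deriv_nonpos (convex_Iic 0) hBs.continuous.continuousOn
      (hBs.differentiable (by simp)).differentiableOn fun s hs => ?_
    rw [interior_Iic] at hs
    rw [(hB s).deriv, Real.smoothTransition.zero_of_nonpos (le_of_lt hs)]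
  have hstrict : StrictMonoOn B (Ici 0) := by
    refine strictMonoOn_of_deriv_pos (convex_Ici 0) hBs.continuous.continuousOn fun s hs => ?_
    rw [interior_Ici] at hs
    rw [(hB s).deriv]
    exact Real.smoothTransition.pos_of_pos hs
  refine ⟨B, hBs.continuous, hB, fun s => ?_, hB0, fun s hs => ?_⟩
  · rcases le_total 0 s with h | h
    · exact hB0 ▸ hmono h
    · exact hB0 ▸ hanti h (mem_Iic.2 le_rfl) h
  · by_contra! h
    have := hstrict (mem_Ici.2 le_rfl) (mem_Ici.2 h.le) h
    rw [hs, hB0] at this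
    exact lt_irrefl _ this

theorem tsupport_comp_sub (η : ℝ → ℝ) (t : ℝ) {s : ℝ} (hs : s ∈ tsupport fun s => η (s - t)) :
    s - t ∈ tsupport η := by
  have := tsupport_comp_subset_preimage (g := η) (f := fun s : ℝ => s - t) (by fun_prop)
  exact this hs

section MaximumPrinciple

variable {T κ C M U : ℝ} {u : Fin d → Torus d → ℝ} {F : Torus d → ℝ}
  {w : ℝ × Torus d → ℝ} {G : Fin d → ℝ × Torus d → ℝ}

theorem HasWeakPartial.sub_const {i : Fin d} {v g : Torus d → ℝ} (h : HasWeakPartial i v g)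
    (hv : MemLp v 2 volume) (c : ℝ) : HasWeakPartial i (fun x => v x - c) g := fun ψ hψ => by
  have hc := hψ.of_top.continuous_partialDeriv i
  have h1 : Integrable (fun x => v x * partialDeriv i ψ x) volume :=
    hv.integrable_mul (memLp_of_continuous hc 2)
  simp only [sub_mul]
  rw [integral_sub h1 ((integrable_of_continuous hc).const_mul c), integral_const_mul,
    integral_partialDeriv hψ.of_top, mul_zero, sub_zero, h ψ hψ]

/-- The time-regularised equation satisfies the renormalised inequality, after subtraction of a
constant `c`. -/
theorem IsForcedSolution.renormalized (h : IsForcedSolution T κ C M U u F w G) (hT : 0 ≤ T)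
    (hκ : 0 ≤ κ) {ζ : ℝ → ℝ} (hζ : ContDiff ℝ ∞ ζ) (hζc : HasCompactSupport ζ)
    (hζs : tsupport ζ ⊆ Iio T) (c : ℝ) {b b' : ℝ → ℝ} {m L : ℝ}
    (hb : ContDiff ℝ ∞ b) (hb' : ∀ s, HasDerivAt b (b' s) s)
    (hm₀ : 0 ≤ m) (hm : ∀ s, m ≤ b' s) (hL : ∀ s, b' s ≤ L) :
    (∫ x, -timeAvg T (deriv ζ) w x * b (timeAvg T ζ w x - c)) +
      κ * (m * ∑ i, ∫ x, timeAvg T ζ (G i) x * timeAvg T ζ (G i) x) ≤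
    ∫ x, (-(∫ s, ζ s ∂(timeMeasure T)) * F x) * b (timeAvg T ζ w x - c) := by
  obtain ⟨K, hK⟩ := hζc.exists_bound_of_continuous hζ.continuous
  have hζ'c : Continuous (deriv ζ) := hζ.continuous_deriv (by simp)
  obtain ⟨K', hK'⟩ := hζc.deriv.exists_bound_of_continuous hζ'c
  have hV := memLp_timeAvg_of_bdd hT hζ.continuous hK h.measurable h.bdd 2
  have hF : MemLp F 2 volume := MemLp.of_bound h.forcing_meas C h.forcing_bdd
  refine renormalized_inequality hκ
    (memLp_timeAvg_of_bdd hT hζ'c hK' h.measurable h.bdd 2).neg (hV.sub (memLp_const c))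
    (hF.const_mul _) (fun i => memLp_timeAvg hζ.continuous hK (h.grad_measurable i) (h.grad_memLp i))
    h.drift_meas h.drift_bdd h.divFree (fun i => (h.hasGrad ζ hζ hζc i).sub_const hV c)
    (fun ψ hψ => ?_) hb hb' hm₀ hm hL
  have e1 := h.equation ζ hζ hζc hζs ψ hψ
  -- Subtracting a constant leaves the transport term unchanged because `u` is divergence-free.
  have e2 : ∑ i, (∫ x, (timeAvg T ζ w x - c) * u i x * partialDeriv i ψ x) =
      ∑ i, (∫ x, timeAvg T ζ w x * u i x * partialDeriv i ψ x) := by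
    rw [← sub_zero (∑ i, (∫ x, timeAvg T ζ w x * u i x * partialDeriv i ψ x)),
      ← mul_zero c, ← h.divFree ψ hψ, Finset.mul_sum, ← Finset.sum_sub_distrib]
    refine Finset.sum_congr rfl fun i _ => ?_
    have hp : MemLp (partialDeriv i ψ) 2 volume :=
      memLp_of_continuous (hψ.of_top.continuous_partialDeriv i) 2
    have hup : MemLp (fun x => u i x * partialDeriv i ψ x) 2 volume :=
      memLp_bdd_mul (h.drift_meas i) (h.drift_bdd i) hp
    rw [← integral_const_mul, ← integral_sub]
    · congr 1; ext x; ring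
    · exact (hV.integrable_mul hup).congr (ae_of_all _ fun x => by simp [mul_assoc])
    · exact (hup.integrable one_le_two).const_mul c
  simp only [Pi.sub_apply, Pi.neg_apply]
  rw [e2]
  simp only [neg_mul, mul_assoc, integral_neg, integral_const_mul] at e1 ⊢
  linarith

/-- One-sided maximum principle for the time derivative of a forced solution. -/
theorem IsForcedSolution.timeAvg_deriv_le (h : IsForcedSolution T κ C M U u F w G) (hT : 0 < T)
    (hκ : 0 ≤ κ) (hC : 0 ≤ C) {η : ℝ → ℝ} (hη : ContDiff ℝ ∞ η) (hηc : HasCompactSupport η)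
    (hηs : tsupport η ⊆ Iio T) (hη0 : ∀ s, 0 ≤ η s) :
    ∀ᵐ x, timeAvg T (deriv η) w x ≤ C * ∫ s, η s ∂(timeMeasure T) := by
  obtain ⟨B, hBc, hB, hBnn, hB0, hBz⟩ := exists_smoothTransition_primitive
  obtain ⟨L, hL⟩ := exists_deriv_smoothTransition_le
  have hη1 : ContDiff ℝ ∞ (deriv η) := (contDiff_infty_iff_deriv.1 hη).2
  have hη2 : ContDiff ℝ ∞ (deriv (deriv η)) := (contDiff_infty_iff_deriv.1 hη1).2
  obtain ⟨K0, hK0⟩ := hηc.exists_bound_of_continuous hη.continuous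
  obtain ⟨K1, hK1⟩ := hηc.deriv.exists_bound_of_continuous hη1.continuous
  obtain ⟨K2, hK2⟩ := hηc.deriv.deriv.exists_bound_of_continuous hη2.continuous
  -- Up to sign, `V t` is the time derivative of `w` averaged with the weight `η(· - t)`, and `z =
  -- ∂_t V`. The shift `t` runs from `-T`, where `V` vanishes, to `0`, where `V` is the quantity to
  -- be estimated. The barrier is `C σ(t)`.
  set V : ℝ → Torus d → ℝ := fun t => timeAvg T (fun s => deriv η (s - t)) w with hVdef
  set z : ℝ → Torus d → ℝ := fun t x => -timeAvg T (fun s => deriv (deriv η) (s - t)) w x with hzdef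
  set σ : ℝ → ℝ := fun t => ∫ s in (-T)..t, η (-s) with hσdef
  have hVt : ∀ x t, HasDerivAt (fun t => V t x) (z t x) t := fun x t =>
    hasDerivAt_timeAvg hη1.continuous hη2.continuous
      (fun s => (hη1.differentiable (by simp) s).hasDerivAt) hK2 h.measurable h.bdd x t
  have hcn : Continuous fun s => η (-s) := hη.continuous.comp continuous_neg
  have hσt : ∀ t, HasDerivAt σ (η (-t)) t := fun t =>
    intervalIntegral.integral_hasDerivAt_right (hcn.intervalIntegrable _ _)
      (hcn.stronglyMeasurableAtFilter _ _) hcn.continuousAt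
  set Y : ℝ → Torus d → ℝ := fun t x => V t x - C * σ t with hYdef
  set Y' : ℝ → Torus d → ℝ := fun t x => z t x - C * η (-t) with hY'def
  have hYt : ∀ x t, HasDerivAt (fun t => Y t x) (Y' t x) t := fun x t =>
    (hVt x t).sub ((hσt t).const_mul C)
  have hVm : ∀ t, Measurable (V t) := fun t =>
    measurable_timeAvg (hη1.continuous.comp (by fun_prop)) h.measurable
  have hzm : ∀ t, Measurable (z t) := fun t =>
    (measurable_timeAvg (hη2.continuous.comp (by fun_prop)) h.measurable).neg
  have hYm : ∀ t, Measurable (Y t) := fun t => (hVm t).sub measurable_const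
  have hVb : ∀ t x, |V t x| ≤ K1 * M * T := fun t x =>
    abs_timeAvg_le hT.le (fun s => hK1 _) h.bdd x
  have hzb : ∀ t x, |z t x| ≤ K2 * M * T := fun t x => by
    rw [hzdef, abs_neg]
    exact abs_timeAvg_le hT.le (fun s => hK2 _) h.bdd x
  have hY'b : ∀ t x, |Y' t x| ≤ K2 * M * T + C * K0 := fun t x =>
    (abs_sub _ _).trans (add_le_add (hzb t x) (by
      rw [abs_mul, abs_of_nonneg hC]; exact mul_le_mul_of_nonneg_left (hK0 _) hC))
  have hsm : Continuous Real.smoothTransition := Real.smoothTransition.continuous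
  have hsb : ∀ r, |Real.smoothTransition r| ≤ 1 := fun r => by
    rw [abs_of_nonneg (Real.smoothTransition.nonneg r)]; exact Real.smoothTransition.le_one r
  have hBYint : ∀ t, Integrable (fun x => B (Y t x)) volume := fun t => by
    obtain ⟨R, hR⟩ := (isCompact_Icc (a := -(K1 * M * T + |C * σ t|))
      (b := K1 * M * T + |C * σ t|)).exists_bound_of_continuousOn hBc.continuousOn
    refine Integrable.of_bound (hBc.measurable.comp (hYm t)).aestronglyMeasurable R
      (ae_of_all _ fun x => hR _ (abs_le.1 ?_))
    exact (abs_sub _ _).trans (add_le_add (hVb t x) le_rfl)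
  have hE : ∀ t, HasDerivAt (fun t => ∫ x, B (Y t x))
      (∫ x, Real.smoothTransition (Y t x) * Y' t x) t := fun t =>
    (hasDerivAt_integral_of_dominated_loc_of_deriv_le (μ := (volume : Measure (Torus d)))
      (F := fun t x => B (Y t x)) (F' := fun t x => Real.smoothTransition (Y t x) * Y' t x)
      (x₀ := t) (s := univ) (bound := fun _ => 1 * (K2 * M * T + C * K0)) univ_mem
      (Eventually.of_forall fun t => (hBYint t).1) (hBYint t)
      ((hsm.measurable.comp (hYm t)).mul ((hzm t).sub measurable_const)).aestronglyMeasurable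
      (ae_of_all _ fun x t _ => by
        rw [norm_mul]
        exact mul_le_mul (hsb _) (hY'b t x) (norm_nonneg _) zero_le_one)
      (integrable_const _)
      (ae_of_all _ fun x t _ => (hB (Y t x)).comp t (hYt x t))).2
  -- The equation averaged with `η'(· - t)` has source `η(-t) F`, which is at most `C η(-t)`, the
  -- growth rate of the barrier. So `∫ B(V - C σ)` cannot increase. Only nonnegativity of the
  -- diffusion is needed, hence `m = 0`.
  have hE' : ∀ t ≤ 0, ∫ x, Real.smoothTransition (Y t x) * Y' t x ≤ 0 := fun t ht => by
    have hsup : tsupport (fun s => deriv η (s - t)) ⊆ Iio T := fun s hs => by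
      have h1 : s - t < T := hηs (tsupport_deriv_subset (tsupport_comp_sub _ t hs))
      exact mem_Iio.2 (by linarith)
    have hcs : HasCompactSupport (fun s => deriv η (s - t)) :=
      hηc.deriv.comp_homeomorph (Homeomorph.subRight t)
    have hr := h.renormalized hT.le hκ (ζ := fun s => deriv η (s - t))
      (hη1.comp (contDiff_id.sub contDiff_const)) hcs hsup (C * σ t)
      (b := Real.smoothTransition) (b' := deriv Real.smoothTransition) (m := 0) (L := L)
      Real.smoothTransition.contDiff
      (fun s => ((Real.smoothTransition.contDiff (n := 1)).differentiable (by simp) s).hasDerivAt)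
      le_rfl (fun s => Real.smoothTransition.monotone.deriv_nonneg) hL
    have hd : deriv (fun s => deriv η (s - t)) = fun s => deriv (deriv η) (s - t) := by
      ext s; rw [deriv_comp_sub_const]
    -- For `t ≤ 0` the endpoint `T - t` lies outside the support of `η`, so only the value at time
    -- `0` survives: it is the smeared initial value of `∂_t w`.
    have hI : ∫ s, deriv η (s - t) ∂(timeMeasure T) = -η (-t) := by
      rw [← integral_Ioc_eq_integral_Ioo, ← intervalIntegral.integral_of_le hT.le,
        intervalIntegral.integral_comp_sub_right (deriv η) t,
        intervalIntegral.integral_deriv_eq_sub (fun s _ => hη.differentiable (by simp) s)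
          (hη1.continuous.intervalIntegrable _ _)]
      rw [image_eq_zero_of_notMem_tsupport (f := η) (x := T - t)
        fun h' => by have : T - t < T := hηs h'; linarith, zero_sub, zero_sub]
    rw [hd, hI] at hr
    simp only [zero_mul, mul_zero, add_zero, neg_neg] at hr
    have i1 : Integrable (fun x => Real.smoothTransition (Y t x)) volume :=
      Integrable.of_bound (hsm.measurable.comp (hYm t)).aestronglyMeasurable 1
        (ae_of_all _ fun x => hsb _)
    have i2 : Integrable (fun x => z t x * Real.smoothTransition (Y t x)) volume :=
      i1.bdd_mul (c := K2 * M * T) (hzm t).aestronglyMeasurable (ae_of_all _ fun x => hzb t x)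
    have i3 : Integrable (fun x => η (-t) * F x * Real.smoothTransition (Y t x)) volume := by
      simp only [mul_assoc]
      exact (i1.bdd_mul (c := C) h.forcing_meas h.forcing_bdd).const_mul _
    have e1 : ∫ x, Real.smoothTransition (Y t x) * Y' t x =
        (∫ x, z t x * Real.smoothTransition (Y t x)) -
          C * η (-t) * ∫ x, Real.smoothTransition (Y t x) := by
      rw [← integral_const_mul, ← integral_sub i2 (i1.const_mul _)]
      congr 1; ext x; simp only [hY'def]; ring
    have e2 : ∫ x, η (-t) * F x * Real.smoothTransition (Y t x) ≤
        C * η (-t) * ∫ x, Real.smoothTransition (Y t x) := by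
      rw [← integral_const_mul]
      refine integral_mono_ae i3 (i1.const_mul _) ?_
      filter_upwards [h.forcing_bdd] with x hx
      refine mul_le_mul_of_nonneg_right ?_ (Real.smoothTransition.nonneg _)
      rw [mul_comm C]
      exact mul_le_mul_of_nonneg_left ((le_abs_self _).trans hx) (hη0 _)
    rw [e1]
    have e3 := hr.trans e2
    linarith
  have hanti : AntitoneOn (fun t => ∫ x, B (Y t x)) (Iic 0) := by
    refine antitoneOn_of_deriv_nonpos (convex_Iic 0)
      (fun t _ => (hE t).continuousAt.continuousWithinAt)
      (fun t _ => (hE t).differentiableAt.differentiableWithinAt) fun t ht => ?_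
    rw [interior_Iic] at ht
    rw [(hE t).deriv]
    exact hE' t (le_of_lt ht)
  -- At `t = -T` the weight `η'(s + T)` vanishes for every `s > 0`, as `η` is supported before `T`.
  have hV0 : ∀ x, Y (-T) x = 0 := fun x => by
    have h1 : σ (-T) = 0 := by simp [hσdef]
    simp only [hYdef, h1, mul_zero, sub_zero, hVdef, timeAvg]
    rw [setIntegral_eq_zero_of_forall_eq_zero]
    intro s hs
    rw [image_eq_zero_of_notMem_tsupport (f := deriv η), zero_mul]
    intro h'
    have h2 : s - -T < T := hηs (tsupport_deriv_subset h')
    linarith [hs.1]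
  have hle := hanti (mem_Iic.2 (neg_nonpos.2 hT.le)) (mem_Iic.2 le_rfl) (neg_nonpos.2 hT.le)
  simp only [hV0, hB0, integral_zero] at hle
  have hz0 := (integral_eq_zero_iff_of_nonneg (fun x => hBnn _) (hBYint 0)).1
    (le_antisymm hle (integral_nonneg fun x => hBnn _))
  have hσ0 : σ 0 = ∫ s, η s ∂(timeMeasure T) := by
    rw [← integral_Ioc_eq_integral_Ioo, ← intervalIntegral.integral_of_le hT.le]
    simp [hσdef, intervalIntegral.integral_comp_neg]
  filter_upwards [hz0] with x hx
  have := hBz _ hx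
  simp only [hYdef, hVdef, sub_zero, hσ0] at this
  linarith

/-- Linearity: apply the one-sided bound to `w` and to `-w`. The weight need not vanish at time `0`,
so the bound also controls the extension of `w` by zero to negative times. -/
theorem IsForcedSolution.abs_timeAvg_deriv_le (h : IsForcedSolution T κ C M U u F w G) (hT : 0 < T)
    (hκ : 0 ≤ κ) (hC : 0 ≤ C) {η : ℝ → ℝ} (hη : ContDiff ℝ ∞ η) (hηc : HasCompactSupport η)
    (hηs : tsupport η ⊆ Iio T) (hη0 : ∀ s, 0 ≤ η s) :
    ∀ᵐ x, |timeAvg T (deriv η) w x| ≤ C * ∫ s, η s ∂(timeMeasure T) := by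
  filter_upwards [h.timeAvg_deriv_le hT hκ hC hη hηc hηs hη0,
    h.neg.timeAvg_deriv_le hT hκ hC hη hηc hηs hη0] with x h1 h2
  rw [timeAvg_neg] at h2
  exact abs_le.2 ⟨by linarith, h1⟩

end MaximumPrinciple

/-! ### From weak solutions to forced solutions -/

theorem isTestFunction_mul {I : Set ℝ} {ζ : ℝ → ℝ} (hζ : ContDiff ℝ ∞ ζ)
    (hc : HasCompactSupport ζ) (hs : tsupport ζ ⊆ I) {ψ : Torus d → ℝ} (hψ : TorusContDiff ⊤ ψ) :
    IsTestFunction I (fun p : ℝ × Torus d => ζ p.1 * ψ p.2) := by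
  have hsub : Function.support (fun p : ℝ × Torus d => ζ p.1 * ψ p.2) ⊆ tsupport ζ ×ˢ univ :=
    fun p hp => ⟨subset_tsupport _ (left_ne_zero_of_mul hp), trivial⟩
  refine ⟨?_, ?_, ?_⟩
  · exact (hζ.comp contDiff_fst).mul ((show ContDiff ℝ ∞ (fun y => ψ (toTorus y)) from hψ).comp contDiff_snd)
  · exact HasCompactSupport.of_support_subset_isCompact (IsCompact.prod hc isCompact_univ) hsub
  · exact (closure_minimal hsub ((isClosed_tsupport ζ).prod isClosed_univ)).trans
      (prod_mono hs Subset.rfl)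

theorem timeDeriv_mul (ζ : ℝ → ℝ) (ψ : Torus d → ℝ) (p : ℝ × Torus d) :
    timeDeriv (fun p : ℝ × Torus d => ζ p.1 * ψ p.2) p = deriv ζ p.1 * ψ p.2 := by
  simp [timeDeriv]

theorem spaceGrad_mul (ζ : ℝ → ℝ) (ψ : Torus d → ℝ) (p : ℝ × Torus d) (i : Fin d) :
    spaceGrad (fun p : ℝ × Torus d => ζ p.1 * ψ p.2) p i = ζ p.1 * partialDeriv i ψ p.2 := by
  simp [spaceGrad, grad, partialDeriv]

theorem inner_eq_sum (a b : EuclideanSpace ℝ (Fin d)) : inner ℝ a b = ∑ i, a i * b i := by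
  simp [PiLp.inner_apply, mul_comm]

section Fubini

variable {T : ℝ} {w : ℝ × Torus d → ℝ} {ζ : ℝ → ℝ} {p : Torus d → ℝ} {K P : ℝ}

theorem integrable_weight_mul (hζ : Continuous ζ) (hK : ∀ s, |ζ s| ≤ K)
    (hw : Integrable w (spaceTimeMeasure d T)) (hp : AEStronglyMeasurable p volume)
    (hP : ∀ᵐ x, |p x| ≤ P) :
    Integrable (fun q : ℝ × Torus d => ζ q.1 * w q * p q.2) (spaceTimeMeasure d T) := by
  refine (hw.bdd_mul (c := K) (hζ.measurable.comp measurable_fst).aestronglyMeasurable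
    (ae_of_all _ fun q => hK _)).mul_bdd (c := P) (hp.comp_quasiMeasurePreserving
      Measure.quasiMeasurePreserving_snd) ?_
  exact Measure.quasiMeasurePreserving_snd.ae hP

theorem integral_timeAvg_mul (hζ : Continuous ζ) (hK : ∀ s, |ζ s| ≤ K)
    (hw : Integrable w (spaceTimeMeasure d T)) (hp : AEStronglyMeasurable p volume)
    (hP : ∀ᵐ x, |p x| ≤ P) :
    ∫ x, timeAvg T ζ w x * p x = ∫ q, ζ q.1 * w q * p q.2 ∂(spaceTimeMeasure d T) := by
  rw [integral_prod_symm _ (integrable_weight_mul hζ hK hw hp hP)]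
  refine integral_congr_ae (ae_of_all _ fun x => ?_)
  simp only [timeAvg, ← integral_mul_const]

theorem integral_integral_mul (hζ : Continuous ζ) (hK : ∀ s, |ζ s| ≤ K)
    (hw : Integrable w (spaceTimeMeasure d T)) (hp : AEStronglyMeasurable p volume)
    (hP : ∀ᵐ x, |p x| ≤ P) :
    ∫ s, ζ s * (∫ x, w (s, x) * p x) ∂(timeMeasure T) =
      ∫ q, ζ q.1 * w q * p q.2 ∂(spaceTimeMeasure d T) := by
  rw [integral_prod _ (integrable_weight_mul hζ hK hw hp hP)]
  refine integral_congr_ae (ae_of_all _ fun s => ?_)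
  simp only [← integral_const_mul, mul_assoc]

theorem integral_weight_mul_const (f : Torus d → ℝ) :
    ∫ q, ζ q.1 * f q.2 ∂(spaceTimeMeasure d T) =
      (∫ s, ζ s ∂(timeMeasure T)) * ∫ x, f x :=
  integral_prod_mul ζ f

end Fubini

theorem TorusContDiff.hasWeakPartial {f : Torus d → ℝ} (hf : TorusContDiff 1 f) (i : Fin d) :
    HasWeakPartial i f (AdvDiff.partialDeriv i f) := fun _ hψ =>
  integral_mul_partialDeriv hf hψ.of_top i

theorem exists_bound_of_continuous {f : Torus d → ℝ} (hf : Continuous f) :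
    ∃ P, ∀ᵐ x, |f x| ≤ P := ⟨supNorm f, ae_of_all _ (abs_le_supNorm hf)⟩

/-- A divergence-free field may be integrated by parts against `C^1` functions. -/
theorem sum_integral_transport {u : Fin d → Torus d → ℝ} {U : ℝ}
    (hu : ∀ i, AEStronglyMeasurable (u i) volume) (hU : ∀ i, ∀ᵐ x, |u i x| ≤ U)
    (hdiv : ∀ ψ, TorusContDiff ⊤ ψ → ∑ i, (∫ x, u i x * partialDeriv i ψ x) = 0)
    {f ψ : Torus d → ℝ} (hf : TorusContDiff 1 f) (hψ : TorusContDiff ⊤ ψ) :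
    ∑ i, (∫ x, f x * (u i x * partialDeriv i ψ x)) =
      -∑ i, (∫ x, partialDeriv i f x * (u i x * ψ x)) := by
  obtain ⟨φ, hφ, h1, h2⟩ := exists_smooth_approx (memLp_of_continuous hf.continuous 2)
    (fun i => memLp_of_continuous (hf.continuous_partialDeriv i) 2) hf.hasWeakPartial
  have m1 : ∀ i, MemLp (fun x => u i x * partialDeriv i ψ x) 2 volume := fun i =>
    memLp_bdd_mul (hu i) (hU i) (memLp_of_continuous (hψ.of_top.continuous_partialDeriv i) 2)
  have m2 : ∀ i, MemLp (fun x => u i x * ψ x) 2 volume := fun i =>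
    memLp_bdd_mul (hu i) (hU i) (memLp_of_continuous hψ.continuous 2)
  have m3 : ∀ n, MemLp (φ n) 2 volume := fun n => memLp_of_continuous (hφ n).continuous 2
  have m4 : ∀ i n, MemLp (partialDeriv i (φ n)) 2 volume := fun i n =>
    memLp_of_continuous ((hφ n).of_top.continuous_partialDeriv i) 2
  have t1 := tendsto_finsetSum Finset.univ fun i _ => tendsto_integral_mul_of_L2 m3
    (memLp_of_continuous hf.continuous 2) (fun _ => m1 i) (m1 i) h1 (by simp)
  have t2 := tendsto_finsetSum Finset.univ fun i _ => tendsto_integral_mul_of_L2 (m4 i)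
    (memLp_of_continuous (hf.continuous_partialDeriv i) 2) (fun _ => m2 i) (m2 i) (h2 i) (by simp)
  have t3 := t1.add t2
  rw [eq_neg_iff_add_eq_zero]
  refine tendsto_nhds_unique t3 ((tendsto_const_nhds (x := (0 : ℝ))).congr fun n => ?_)
  rw [← hdiv _ ((hφ n).mul hψ), ← Finset.sum_add_distrib]
  refine Finset.sum_congr rfl fun i _ => ?_
  have h3 := integral_add ((m3 n).integrable_mul (m1 i)) ((m4 i n).integrable_mul (m2 i))
  simp only [Pi.mul_apply] at h3
  rw [← h3]
  refine integral_congr_ae (ae_of_all _ fun x => ?_)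
  dsimp only
  rw [partialDeriv_mul (hφ n).of_top hψ.of_top]
  ring

theorem integral_deriv_timeMeasure {T : ℝ} (hT : 0 ≤ T) {ζ : ℝ → ℝ} (hζ : ContDiff ℝ ∞ ζ)
    (hs : tsupport ζ ⊆ Iio T) : ∫ s, deriv ζ s ∂(timeMeasure T) = -ζ 0 := by
  rw [← integral_Ioc_eq_integral_Ioo, ← intervalIntegral.integral_of_le hT,
    intervalIntegral.integral_deriv_eq_sub (fun s _ => hζ.differentiable (by simp) s)
      ((hζ.continuous_deriv (by simp)).intervalIntegrable _ _),
    image_eq_zero_of_notMem_tsupport (f := ζ) (x := T) fun h' => lt_irrefl T (hs h'), zero_sub]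

/-- The residual `u · ∇θ₀ - κ Δθ₀` of a time-independent `θ₀`. -/
noncomputable def forcing (κ : ℝ) (u : Torus d → EuclideanSpace ℝ (Fin d)) (θ₀ : Torus d → ℝ)
    (x : Torus d) : ℝ :=
  ∑ i, u x i * partialDeriv i θ₀ x - κ * ∑ i, partialDeriv i (partialDeriv i θ₀) x

/-- This is where the constant of the theorem arises. The transport part uses `|u_i| ≤ U` in each
coordinate; the Laplacian consists of the diagonal second derivatives, with `κ < 1`. -/
theorem abs_forcing_le {κ U : ℝ} (hκ : κ ∈ Ioo (0 : ℝ) 1) {u : Torus d → EuclideanSpace ℝ (Fin d)}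
    {θ₀ : Torus d → ℝ} (hθ₀ : TorusContDiff 2 θ₀) {x : Torus d} (hU : ∀ i, |u x i| ≤ U)
    (hU0 : 0 ≤ U) : |forcing κ u θ₀ x| ≤ U * normC1 θ₀ + normC2 θ₀ := by
  have h1 : TorusContDiff 1 θ₀ := hθ₀.of_le (by norm_num)
  have h2 : ∀ i, TorusContDiff 1 (partialDeriv i θ₀) := fun i => hθ₀.partialDeriv (by norm_num) i
  have e1 : |∑ i, u x i * partialDeriv i θ₀ x| ≤ U * normC1 θ₀ := by
    refine (Finset.abs_sum_le_sum_abs _ _).trans ?_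
    calc ∑ i, |u x i * partialDeriv i θ₀ x| ≤ ∑ i, U * supNorm (partialDeriv i θ₀) :=
          Finset.sum_le_sum fun i _ => by
            rw [abs_mul]
            exact mul_le_mul (hU i) (abs_le_supNorm (h1.continuous_partialDeriv i) x)
              (abs_nonneg _) hU0
      _ ≤ U * normC1 θ₀ := by
          rw [← Finset.mul_sum, normC1]
          exact mul_le_mul_of_nonneg_left (le_add_of_nonneg_left (supNorm_nonneg _)) hU0
  have e2 : |κ * ∑ i, partialDeriv i (partialDeriv i θ₀) x| ≤ normC2 θ₀ := by
    rw [abs_mul, abs_of_pos hκ.1]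
    refine (mul_le_of_le_one_left (abs_nonneg _) hκ.2.le).trans ?_
    refine (Finset.abs_sum_le_sum_abs _ _).trans ?_
    have hC1 : 0 ≤ normC1 θ₀ :=
      add_nonneg (supNorm_nonneg _) (Finset.sum_nonneg fun i _ => supNorm_nonneg _)
    refine le_trans ?_ (le_add_of_nonneg_left hC1)
    refine Finset.sum_le_sum fun i _ => ?_
    refine (abs_le_supNorm ((h2 i).continuous_partialDeriv i) x).trans ?_
    exact Finset.single_le_sum (f := fun j => supNorm (partialDeriv i (partialDeriv j θ₀)))
      (fun j _ => supNorm_nonneg _) (Finset.mem_Ici.2 le_rfl)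
  exact (abs_sub _ _).trans (add_le_add e1 e2)

theorem ae_norm_le_toReal_eLpNorm {α E : Type*} [MeasurableSpace α] [NormedAddCommGroup E]
    {μ : Measure α} {f : α → E} (hf : MemLp f ∞ μ) :
    ∀ᵐ x ∂μ, ‖f x‖ ≤ (eLpNorm f ∞ μ).toReal := by
  filter_upwards [ae_le_eLpNormEssSup (f := f) (μ := μ)] with x h2
  rw [← eLpNorm_exponent_top] at h2
  have := ENNReal.toReal_mono hf.2.ne h2
  rwa [toReal_enorm] at this

theorem exists_measurable_bdd_representative {α : Type*} [MeasurableSpace α] {μ : Measure α}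
    {f : α → ℝ} (hf : MemLp f ∞ μ) :
    ∃ g : α → ℝ, ∃ M, Measurable g ∧ (∀ x, |g x| ≤ M) ∧ f =ᵐ[μ] g := by
  set M := (eLpNorm f ∞ μ).toReal
  have hM : 0 ≤ M := ENNReal.toReal_nonneg
  refine ⟨fun x => max (-M) (min M (hf.1.aemeasurable.mk f x)), M,
    measurable_const.max (measurable_const.min hf.1.aemeasurable.measurable_mk), fun x => ?_, ?_⟩
  · exact abs_le.2 ⟨le_max_left _ _, max_le (by linarith) (min_le_left _ _)⟩
  · filter_upwards [hf.1.aemeasurable.ae_eq_mk, ae_norm_le_toReal_eLpNorm hf] with x h1 h3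
    rw [Real.norm_eq_abs] at h3
    rw [← h1, min_eq_right (abs_le.1 h3).2, max_eq_right (abs_le.1 h3).1]

/-- A weak derivative relation for time weights supported in `(0, T)` holds for all time weights. -/
theorem hasWeakPartial_timeAvg {T : ℝ} {w g : ℝ × Torus d → ℝ} {i : Fin d}
    (hw : Integrable w (spaceTimeMeasure d T)) (hg : Integrable g (spaceTimeMeasure d T))
    (h : ∀ ζ : ℝ → ℝ, ContDiff ℝ ∞ ζ → HasCompactSupport ζ → tsupport ζ ⊆ Ioo 0 T →
      HasWeakPartial i (timeAvg T ζ w) (timeAvg T ζ g))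
    {ζ : ℝ → ℝ} (hζ : ContDiff ℝ ∞ ζ) (hc : HasCompactSupport ζ) :
    HasWeakPartial i (timeAvg T ζ w) (timeAvg T ζ g) := by
  intro ψ hψ
  obtain ⟨P, hP⟩ := exists_bound_of_continuous hψ.continuous
  obtain ⟨Q, hQ⟩ := exists_bound_of_continuous (hψ.of_top.continuous_partialDeriv i)
  have mP := hψ.continuous.aestronglyMeasurable_of_compactSpace (μ := (volume : Measure (Torus d)))
  have mQ := (hψ.of_top.continuous_partialDeriv i).aestronglyMeasurable_of_compactSpace
    (μ := (volume : Measure (Torus d)))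
  have one : ∀ s : ℝ, |(fun _ : ℝ => (1 : ℝ)) s| ≤ 1 := by simp
  have ia : Integrable (fun s => ∫ x, w (s, x) * partialDeriv i ψ x) (timeMeasure T) := by
    simpa using (integrable_weight_mul continuous_const one hw mQ hQ).integral_prod_left
  have ib : Integrable (fun s => ∫ x, g (s, x) * ψ x) (timeMeasure T) := by
    simpa using (integrable_weight_mul continuous_const one hg mP hP).integral_prod_left
  have key : ∀ η : ℝ → ℝ, ContDiff ℝ ∞ η → HasCompactSupport η →
      ∫ s, η s * ((∫ x, w (s, x) * partialDeriv i ψ x) + ∫ x, g (s, x) * ψ x) ∂(timeMeasure T) =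
      (∫ x, timeAvg T η w x * partialDeriv i ψ x) + ∫ x, timeAvg T η g x * ψ x := by
    intro η hη hηc
    obtain ⟨K, hK⟩ := hηc.exists_bound_of_continuous hη.continuous
    simp only [mul_add]
    rw [integral_add (ia.bdd_mul (c := K) hη.continuous.aestronglyMeasurable (ae_of_all _ hK))
      (ib.bdd_mul (c := K) hη.continuous.aestronglyMeasurable (ae_of_all _ hK)),
      integral_integral_mul hη.continuous hK hw mQ hQ,
      integral_integral_mul hη.continuous hK hg mP hP,
      integral_timeAvg_mul hη.continuous hK hw mQ hQ,
      integral_timeAvg_mul hη.continuous hK hg mP hP]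
  -- By the fundamental lemma of the calculus of variations the spatial identity holds at almost
  -- every time in `(0, T)`; any weight can then be integrated against it.
  have hz : ∀ᵐ s, s ∈ Ioo 0 T →
      (∫ x, w (s, x) * partialDeriv i ψ x) + ∫ x, g (s, x) * ψ x = 0 := by
    refine isOpen_Ioo.ae_eq_zero_of_integral_contDiff_smul_eq_zero
      (IntegrableOn.locallyIntegrableOn (ia.add ib)) fun η hη hηc hηs => ?_
    have h1 := key η hη hηc
    rw [h η hη hηc hηs ψ hψ, neg_add_cancel] at h1
    rw [← h1, setIntegral_eq_integral_of_forall_compl_eq_zero]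
    · rfl
    · intro s hs
      rw [image_eq_zero_of_notMem_tsupport fun h' => hs (hηs h'), zero_mul]
  have h2 := key ζ hζ hc
  rw [integral_eq_zero_of_ae] at h2
  · linarith
  · filter_upwards [(ae_restrict_iff' measurableSet_Ioo).2 hz] with s hs
    simp [hs]

theorem IsWeakSolution.exists_isForcedSolution {T κ : ℝ} (hT : 0 < T) (hκ : κ ∈ Ioo (0 : ℝ) 1)
    {u : Torus d → EuclideanSpace ℝ (Fin d)} (hu : MemLp u ∞ volume) (hdiv : IsDivFree u)
    {θ₀ : Torus d → ℝ} (hθ₀ : TorusContDiff 2 θ₀)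
    {θ : ℝ × Torus d → ℝ} {G : ℝ × Torus d → EuclideanSpace ℝ (Fin d)}
    (h : IsWeakSolution T u κ θ₀ θ G) :
    ∃ (M : ℝ) (w : ℝ × Torus d → ℝ) (g : Fin d → ℝ × Torus d → ℝ),
      IsForcedSolution T κ ((eLpNorm u ∞ volume).toReal * normC1 θ₀ + normC2 θ₀) M
        (eLpNorm u ∞ volume).toReal (fun i x => u x i) (forcing κ u θ₀) w g ∧
      (∀ᵐ p ∂(spaceTimeMeasure d T), θ p = w p + θ₀ p.2) ∧
      ∀ i, ∀ᵐ p ∂(spaceTimeMeasure d T), G p i = g i p + partialDeriv i θ₀ p.2 := by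
  have hθ1 : TorusContDiff 1 θ₀ := hθ₀.of_le (by norm_num)
  have hθ2 : ∀ i, TorusContDiff 1 (partialDeriv i θ₀) := fun i => hθ₀.partialDeriv (by norm_num) i
  have c0 := hθ1.continuous
  have c1 := fun i => hθ1.continuous_partialDeriv i
  have c2 := fun i => (hθ2 i).continuous_partialDeriv i
  obtain ⟨θ', M', hm, hM', hae⟩ := exists_measurable_bdd_representative h.bounded
  have hGi : ∀ i, MemLp (fun p => G p i) 2 (spaceTimeMeasure d T) := fun i =>
    (EuclideanSpace.proj (𝕜 := ℝ) i).comp_memLp' h.grad_memLp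
  choose G' hG'm hG'ae using fun i => (hGi i).1.aemeasurable
  have hG' : ∀ i, MemLp (G' i) 2 (spaceTimeMeasure d T) := fun i =>
    (memLp_congr_ae (hG'ae i)).1 (hGi i)
  have hu_ae := ae_norm_le_toReal_eLpNorm hu
  have hUi : ∀ᵐ x, ∀ i, |u x i| ≤ (eLpNorm u ∞ volume).toReal := by
    filter_upwards [hu_ae] with x hx i
    exact (PiLp.norm_apply_le (u x) i).trans hx
  have hum : ∀ i, AEStronglyMeasurable (fun x => u x i) volume := fun i =>
    (EuclideanSpace.proj (𝕜 := ℝ) i).continuous.comp_aestronglyMeasurable hu.1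
  have hUi' : ∀ i, ∀ᵐ x, |u x i| ≤ (eLpNorm u ∞ volume).toReal := fun i => by
    filter_upwards [hUi] with x hx using hx i
  have hdiv' : ∀ ψ, TorusContDiff ⊤ ψ → ∑ i, (∫ x, u x i * partialDeriv i ψ x) = 0 := by
    intro ψ hψ
    rw [← integral_finsetSum _ fun i _ => ?_, ← hdiv ψ hψ]
    · simp only [inner_eq_sum, grad]
    · exact (memLp_bdd_mul (hum i) (hUi' i) (memLp_of_continuous
        (hψ.of_top.continuous_partialDeriv i) 1)).integrable le_rfl
  have iθ' : Integrable θ' (spaceTimeMeasure d T) :=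
    Integrable.of_bound hm.aestronglyMeasurable M' (ae_of_all _ hM')
  have iG' : ∀ i, Integrable (G' i) (spaceTimeMeasure d T) := fun i =>
    (hG' i).integrable one_le_two
  have lift : ∀ {f : Torus d → ℝ}, Continuous f →
      MemLp (fun p : ℝ × Torus d => f p.2) 2 (spaceTimeMeasure d T) := fun {f} hf =>
    MemLp.of_bound (hf.comp continuous_snd).measurable.aestronglyMeasurable (supNorm f)
      (ae_of_all _ fun p => abs_le_supNorm hf p.2)
  -- Subtracting a time-independent function changes the averaged pairing by the mass of the weight
  -- times a spatial integral.
  have split : ∀ {ζ : ℝ → ℝ} {K : ℝ} {f : ℝ × Torus d → ℝ} {f₀ p : Torus d → ℝ} {P : ℝ},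
      Continuous ζ → (∀ s, |ζ s| ≤ K) → Integrable f (spaceTimeMeasure d T) → Continuous f₀ →
      AEStronglyMeasurable p volume → (∀ᵐ x, |p x| ≤ P) →
      ∫ x, timeAvg T ζ (fun q => f q - f₀ q.2) x * p x =
        (∫ q, ζ q.1 * f q * p q.2 ∂(spaceTimeMeasure d T)) -
          (∫ s, ζ s ∂(timeMeasure T)) * ∫ x, f₀ x * p x := by
    intro ζ K f f₀ p P hζ hK hf hf₀ hp hP
    have l := (lift hf₀).integrable one_le_two
    have l' : Integrable (fun q => f q - f₀ q.2) (spaceTimeMeasure d T) := hf.sub l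
    rw [integral_timeAvg_mul hζ hK l' hp hP, ← integral_weight_mul_const]
    rw [← integral_sub (integrable_weight_mul hζ hK hf hp hP)
      ((integrable_weight_mul hζ hK l hp hP).congr (ae_of_all _ fun q => by ring))]
    refine integral_congr_ae (ae_of_all _ fun q => ?_)
    dsimp only
    ring
  refine ⟨M' + supNorm θ₀, fun p => θ' p - θ₀ p.2, fun i p => G' i p - partialDeriv i θ₀ p.2,
    ⟨?_, ?_, ?_, ?_, ?_, ?_, hum, hUi', hdiv', ?_, ?_⟩, ?_, ?_⟩
  · exact hm.sub (c0.comp continuous_snd).measurable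
  · exact fun p => (abs_sub _ _).trans (add_le_add (hM' p) (abs_le_supNorm c0 _))
  · exact fun i => (hG'm i).sub ((c1 i).comp continuous_snd).measurable
  · exact fun i => (hG' i).sub (lift (c1 i))
  · refine AEStronglyMeasurable.sub (Finset.aestronglyMeasurable_fun_sum _ fun i _ =>
      (hum i).mul (c1 i).aestronglyMeasurable_of_compactSpace) ?_
    exact (continuous_const.mul (continuous_finsetSum _ fun i _ =>
      c2 i)).aestronglyMeasurable_of_compactSpace
  · filter_upwards [hUi] with x hx
    exact abs_forcing_le hκ hθ₀ hx ENNReal.toReal_nonneg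
  · intro ζ hζ hc i
    refine hasWeakPartial_timeAvg (iθ'.sub ((lift c0).integrable one_le_two))
      ((iG' i).sub ((lift (c1 i)).integrable one_le_two)) (fun η hη hηc hηs ψ hψ => ?_) hζ hc
    obtain ⟨K, hK⟩ := hηc.exists_bound_of_continuous hη.continuous
    obtain ⟨P, hP⟩ := exists_bound_of_continuous hψ.continuous
    obtain ⟨Q, hQ⟩ := exists_bound_of_continuous (hψ.of_top.continuous_partialDeriv i)
    have e := h.hasGrad _ (isTestFunction_mul hη hηc hηs hψ) i
    simp only [spaceGrad_mul] at e
    have s1 := split hη.continuous hK iθ' c0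
      (hψ.of_top.continuous_partialDeriv i).aestronglyMeasurable_of_compactSpace hQ
    have s2 := split hη.continuous hK (iG' i) (c1 i)
      hψ.continuous.aestronglyMeasurable_of_compactSpace hP
    refine s1.trans (Eq.trans ?_ (congrArg Neg.neg s2).symm)
    have e1 : ∫ q, η q.1 * θ' q * partialDeriv i ψ q.2 ∂(spaceTimeMeasure d T) =
        ∫ p, θ p * (η p.1 * partialDeriv i ψ p.2) ∂(spaceTimeMeasure d T) := by
      refine integral_congr_ae ?_
      filter_upwards [hae] with q hq
      rw [hq]; ring
    have e2 : ∫ q, η q.1 * G' i q * ψ q.2 ∂(spaceTimeMeasure d T) =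
        ∫ p, G p i * (η p.1 * ψ p.2) ∂(spaceTimeMeasure d T) := by
      refine integral_congr_ae ?_
      filter_upwards [hG'ae i] with q hq
      rw [hq]; ring
    rw [e1, e2, e, integral_mul_partialDeriv hθ1 hψ.of_top]
    ring
  · intro ζ hζ hc hs ψ hψ
    have hζ1 : Continuous (deriv ζ) := hζ.continuous_deriv (by simp)
    obtain ⟨K, hK⟩ := hc.exists_bound_of_continuous hζ.continuous
    obtain ⟨K', hK'⟩ := hc.deriv.exists_bound_of_continuous hζ1
    obtain ⟨P, hP⟩ := exists_bound_of_continuous hψ.continuous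
    have cψ := fun i => hψ.of_top.continuous_partialDeriv i
    choose Q hQ using fun i => exists_bound_of_continuous (cψ i)
    have mP := hψ.continuous.aestronglyMeasurable_of_compactSpace
      (μ := (volume : Measure (Torus d)))
    have mQ := fun i => (cψ i).aestronglyMeasurable_of_compactSpace
      (μ := (volume : Measure (Torus d)))
    have bu : ∀ i, ∀ᵐ x, |u x i * partialDeriv i ψ x| ≤ (eLpNorm u ∞ volume).toReal * Q i :=
      fun i => by
        filter_upwards [hUi' i, hQ i] with x h1 h2
        rw [abs_mul]
        exact mul_le_mul h1 h2 (abs_nonneg _) ENNReal.toReal_nonneg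
    have mu : ∀ i, AEStronglyMeasurable (fun x => u x i * partialDeriv i ψ x) volume :=
      fun i => (hum i).mul (mQ i)
    have s0 := split hζ1 hK' iθ' c0 mP hP
    have s1 := fun i => split hζ.continuous hK iθ' c0 (mu i) (bu i)
    have s2 := fun i => split hζ.continuous hK (iG' i) (c1 i) (mQ i) (hQ i)
    have e := h.equation _ (isTestFunction_mul hζ hc hs hψ)
    have i0 := integrable_weight_mul hζ1 hK' iθ' mP hP
    have i1 := fun i => integrable_weight_mul hζ.continuous hK iθ' (mu i) (bu i)
    have i2 := fun i => integrable_weight_mul hζ.continuous hK (iG' i) (mQ i) (hQ i)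
    have e1 : ∫ p, (θ p * (timeDeriv (fun p : ℝ × Torus d => ζ p.1 * ψ p.2) p +
        inner ℝ (u p.2) (spaceGrad (fun p : ℝ × Torus d => ζ p.1 * ψ p.2) p)) -
        κ * inner ℝ (G p) (spaceGrad (fun p : ℝ × Torus d => ζ p.1 * ψ p.2) p))
          ∂(spaceTimeMeasure d T) =
        (∫ q, deriv ζ q.1 * θ' q * ψ q.2 ∂(spaceTimeMeasure d T)) +
        (∑ i, (∫ q, ζ q.1 * θ' q * (u q.2 i * partialDeriv i ψ q.2) ∂(spaceTimeMeasure d T)) -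
        κ * ∑ i, ∫ q, ζ q.1 * G' i q * partialDeriv i ψ q.2 ∂(spaceTimeMeasure d T)) := by
      rw [← integral_finsetSum _ fun i _ => i1 i, ← integral_finsetSum _ fun i _ => i2 i,
        ← integral_const_mul, ← integral_sub (integrable_finsetSum _ fun i _ => i1 i)
        ((integrable_finsetSum _ fun i _ => i2 i).const_mul κ)]
      refine Eq.trans ?_ (integral_add i0 ((integrable_finsetSum _ fun i _ => i1 i).sub
        ((integrable_finsetSum _ fun i _ => i2 i).const_mul κ)))
      refine integral_congr_ae ?_
      filter_upwards [hae, ae_all_iff.2 hG'ae] with p h1 h2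
      simp only [timeDeriv_mul, inner_eq_sum, spaceGrad_mul, h1, h2]
      rw [mul_add, Finset.mul_sum, add_sub_assoc]
      congr 1
      · ring
      · congr 1
        · exact Finset.sum_congr rfl fun i _ => by ring
        · congr 1
          exact Finset.sum_congr rfl fun i _ => by ring
    rw [e1] at e
    have e2 : ∫ x, θ₀ x * (ζ 0 * ψ x) = ζ 0 * ∫ x, θ₀ x * ψ x := by
      rw [← integral_const_mul]
      exact integral_congr_ae (ae_of_all _ fun x => by dsimp only; ring)
    -- The boundary value `-ζ 0` produced by the constant-in-time part cancels the initial-data term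
    -- of the weak formulation. This is how `w` comes to have zero initial value.
    have e3 := integral_deriv_timeMeasure hT.le hζ hs
    -- Moving the derivatives onto `θ₀` turns its transport and diffusion terms into the forcing.
    have e4 := sum_integral_transport hum hUi' hdiv' hθ1 hψ
    have e5 := fun i => integral_mul_partialDeriv (hθ2 i) hψ.of_top i
    have j1 : ∀ i, Integrable (fun x => partialDeriv i θ₀ x * (u x i * ψ x)) volume := fun i =>
      (memLp_of_continuous (c1 i) 2).integrable_mul
        (memLp_bdd_mul (hum i) (hUi' i) (memLp_of_continuous hψ.continuous 2))
    have j2 : ∀ i, Integrable (fun x => partialDeriv i (partialDeriv i θ₀) x * ψ x) volume :=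
      fun i => integrable_of_continuous ((c2 i).mul hψ.continuous)
    have e6 : ∫ x, forcing κ u θ₀ x * ψ x =
        ∑ i, (∫ x, partialDeriv i θ₀ x * (u x i * ψ x)) -
          κ * ∑ i, ∫ x, partialDeriv i (partialDeriv i θ₀) x * ψ x := by
      rw [← integral_finsetSum _ fun i _ => j1 i, ← integral_finsetSum _ fun i _ => j2 i,
        ← integral_const_mul, ← integral_sub (integrable_finsetSum _ fun i _ => j1 i)
        ((integrable_finsetSum _ fun i _ => j2 i).const_mul κ)]
      refine integral_congr_ae (ae_of_all _ fun x => ?_)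
      simp only [forcing, sub_mul, Finset.sum_mul, mul_assoc]
      congr 1
      exact Finset.sum_congr rfl fun i _ => by ring
    simp only [mul_assoc (timeAvg T ζ _ _)]
    rw [s0, Finset.sum_congr rfl fun i _ => s1 i, Finset.sum_congr rfl fun i _ => s2 i, e6,
      Finset.sum_sub_distrib, Finset.sum_sub_distrib, ← Finset.mul_sum, ← Finset.mul_sum, e4,
      Finset.sum_congr rfl fun i _ => e5 i, Finset.sum_neg_distrib, e3]
    rw [e2] at e
    linear_combination e
  · filter_upwards [hae] with p hp
    rw [hp]; ring
  · intro i
    filter_upwards [hG'ae i] with p hp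
    rw [hp]; ring

/-! ### Lipschitz continuity in time -/

/-- A smooth approximate identity on the line that recovers locally integrable functions almost
everywhere. -/
theorem exists_mollifier : ∃ (ρ : ℕ → ℝ → ℝ) (r : ℕ → ℝ), Tendsto r atTop (𝓝 0) ∧
    (∀ n, ContDiff ℝ ∞ (ρ n)) ∧ (∀ n, HasCompactSupport (ρ n)) ∧ (∀ n s, 0 ≤ ρ n s) ∧
    (∀ n, ∫ s, ρ n s = 1) ∧ (∀ n, ∀ s ∈ tsupport (ρ n), |s| ≤ r n) ∧
    ∀ g : ℝ → ℝ, LocallyIntegrable g volume →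
      ∀ᵐ t, Tendsto (fun n => ∫ s, ρ n (s - t) * g s) atTop (𝓝 (g t)) := by
  have hpos : ∀ n : ℕ, (0 : ℝ) < 1 / ((n : ℝ) + 1) := fun n => Nat.one_div_pos_of_nat
  -- The outer radius is twice the inner one: a bounded ratio is what almost-everywhere convergence
  -- for locally integrable functions requires (`K := 2`).
  let φ : ℕ → ContDiffBump (0 : ℝ) := fun n =>
    ⟨1 / ((n : ℝ) + 1), 2 * (1 / ((n : ℝ) + 1)), hpos n, by linarith [hpos n]⟩
  have hr : Tendsto (fun n => (φ n).rOut) atTop (𝓝 0) := by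
    have := (tendsto_one_div_add_atTop_nhds_zero_nat (𝕜 := ℝ)).const_mul 2
    rwa [mul_zero] at this
  refine ⟨fun n => (φ n).normed volume, fun n => (φ n).rOut, hr, fun n => (φ n).contDiff_normed,
    fun n => (φ n).hasCompactSupport_normed, fun n => (φ n).nonneg_normed,
    fun n => (φ n).integral_normed, fun n s hs => ?_, fun g hg => ?_⟩
  · rw [(φ n).tsupport_normed_eq] at hs
    simpa using hs
  · filter_upwards [ContDiffBump.ae_convolution_tendsto_right_of_locallyIntegrable (K := 2) hr
      (Eventually.of_forall fun n => le_rfl) hg] with t ht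
    refine ht.congr fun n => ?_
    rw [convolution_lsmul_swap]
    refine integral_congr_ae (ae_of_all _ fun s => ?_)
    dsimp only
    rw [← ContDiffBump.normed_neg, neg_sub, smul_eq_mul]

theorem setIntegral_timeMeasure {T : ℝ} (f g : ℝ → ℝ) :
    ∫ s, f s * g s ∂(timeMeasure T) = ∫ s, f s * (Ioo 0 T).indicator g s := by
  rw [← integral_indicator measurableSet_Ioo]
  refine integral_congr_ae (ae_of_all _ fun s => ?_)
  by_cases hs : s ∈ Ioo 0 T <;> simp [hs]

theorem continuous_timeAvg {T M : ℝ} {w : ℝ × Torus d → ℝ} {ζ : ℝ → ℝ} (hζ : ContDiff ℝ ∞ ζ)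
    (hc : HasCompactSupport ζ) (hw : Measurable w) (hM : ∀ p, |w p| ≤ M) (x : Torus d) :
    Continuous fun t => timeAvg T (fun s => ζ (s - t)) w x := by
  have h1 := hζ.continuous_deriv (by simp)
  obtain ⟨K, hK⟩ := hc.deriv.exists_bound_of_continuous h1
  exact continuous_iff_continuousAt.2 fun t => (hasDerivAt_timeAvg hζ.continuous h1
    (fun s => (hζ.differentiable (by simp) s).hasDerivAt) hK hw hM x t).continuousAt

section Lipschitz

variable {T κ C M U : ℝ} {u : Fin d → Torus d → ℝ} {F : Torus d → ℝ}
  {w : ℝ × Torus d → ℝ} {G : Fin d → ℝ × Torus d → ℝ}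

theorem integral_comp_sub_timeMeasure_le {ρ : ℝ → ℝ} (hρ : Continuous ρ) (hc : HasCompactSupport ρ)
    (h0 : ∀ s, 0 ≤ ρ s) (h1 : ∫ s, ρ s = 1) (t : ℝ) :
    ∫ s, ρ (s - t) ∂(timeMeasure T) ≤ 1 := by
  rw [← h1, ← integral_sub_right_eq_self ρ t]
  exact setIntegral_le_integral ((hρ.integrable_of_hasCompactSupport hc).comp_sub_right t)
    (ae_of_all _ fun s => h0 _)

/-- The derivative bound, applied to shrinking mollifiers, makes the mollified time slices
`C`-Lipschitz. At Lebesgue points the slice, extended by zero to `t ≤ 0`, inherits this, and a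
Lipschitz extension fills in the null set. -/
theorem IsForcedSolution.ae_exists_lipschitz (h : IsForcedSolution T κ C M U u F w G) (hT : 0 < T)
    (hκ : 0 ≤ κ) (hC : 0 ≤ C) : ∀ᵐ x, ∃ ℓ : ℝ → ℝ, LipschitzWith (Real.toNNReal C) ℓ ∧
      ∀ᵐ t, t < T → (Ioo 0 T).indicator (fun t => w (t, x)) t = ℓ t := by
  obtain ⟨ρ, r, hr, hs, hc, h0, h1, hsup, hconv⟩ := exists_mollifier
  have hs1 : ∀ n, ContDiff ℝ ∞ (deriv (ρ n)) := fun n => (contDiff_infty_iff_deriv.1 (hs n)).2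
  -- The exceptional null set of the maximum principle depends on the weight, so only countably many
  -- shifts are used; continuity in the shift recovers the others.
  have hD : ∀ᵐ x, ∀ n, ∀ q : ℚ, (q : ℝ) + r n < T →
      |timeAvg T (fun s => deriv (ρ n) (s - q)) w x| ≤ C := by
    rw [ae_all_iff]; intro n
    rw [ae_all_iff]; intro q
    by_cases hq : (q : ℝ) + r n < T
    swap
    · exact ae_of_all _ fun x h' => absurd h' hq
    have hd : deriv (fun s => ρ n (s - q)) = fun s => deriv (ρ n) (s - q) := by
      ext s; rw [deriv_comp_sub_const]
    have := h.abs_timeAvg_deriv_le hT hκ hC (η := fun s => ρ n (s - q))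
      ((hs n).comp (contDiff_id.sub contDiff_const))
      ((hc n).comp_homeomorph (Homeomorph.subRight (q : ℝ)))
      (fun s hs => by
        have := (abs_le.1 (hsup n _ (tsupport_comp_sub _ _ hs))).2
        exact mem_Iio.2 (by linarith)) (fun s => h0 n _)
    filter_upwards [this] with x hx _
    rw [hd] at hx
    exact hx.trans (mul_le_of_le_one_right hC
      (integral_comp_sub_timeMeasure_le (hs n).continuous (hc n) (h0 n) (h1 n) q))
  filter_upwards [hD] with x hx
  have hx' : ∀ n, ∀ t, t + r n < T → |timeAvg T (fun s => deriv (ρ n) (s - t)) w x| ≤ C := by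
    intro n t ht
    have hcont := continuous_timeAvg (T := T) (hs1 n) (hc n).deriv h.measurable h.bdd x
    have hcl : IsClosed {t | |timeAvg T (fun s => deriv (ρ n) (s - t)) w x| ≤ C} :=
      isClosed_le hcont.abs continuous_const
    have hop : IsOpen {t | t + r n < T} := isOpen_lt (by fun_prop) continuous_const
    refine hcl.closure_subset_iff.2 ?_
      (Rat.denseRange_cast.open_subset_closure_inter hop ht)
    rintro _ ⟨hq, q, rfl⟩
    exact hx n q hq
  set g : ℝ → ℝ := (Ioo 0 T).indicator (fun t => w (t, x)) with hg
  have hgi : LocallyIntegrable g volume := by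
    refine Integrable.locallyIntegrable ?_
    rw [hg, integrable_indicator_iff measurableSet_Ioo]
    exact Integrable.of_bound (h.measurable.comp (by fun_prop)).aestronglyMeasurable M
      (ae_of_all _ fun s => h.bdd _)
  have hconv' := hconv g hgi
  have hLip : LipschitzOnWith (Real.toNNReal C) g
      {t | t < T ∧ Tendsto (fun n => ∫ s, ρ n (s - t) * g s) atTop (𝓝 (g t))} := by
    refine LipschitzOnWith.of_dist_le_mul fun t ht t' ht' => ?_
    rw [Real.dist_eq, Real.dist_eq, Real.coe_toNNReal C hC]
    refine le_of_tendsto ((ht.2.sub ht'.2).abs) ?_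
    have hev : ∀ {t}, t < T → ∀ᶠ n in atTop, t + r n < T := fun {t} ht => by
      have : Tendsto (fun n => t + r n) atTop (𝓝 (t + 0)) := hr.const_add t
      rw [add_zero] at this
      exact this.eventually_lt_const ht
    filter_upwards [hev ht.1, hev ht'.1] with n h1 h2
    obtain ⟨K, hK⟩ := (hc n).deriv.exists_bound_of_continuous (hs1 n).continuous
    have hmv := (convex_Iio (T - r n)).norm_image_sub_le_of_norm_hasDerivWithin_le
      (f := fun t => timeAvg T (fun s => ρ n (s - t)) w x)
      (f' := fun t => -timeAvg T (fun s => deriv (ρ n) (s - t)) w x) (C := C)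
      (x := t') (y := t)
      (fun t _ => (hasDerivAt_timeAvg (hs n).continuous (hs1 n).continuous
        (fun s => ((hs n).differentiable (by simp) s).hasDerivAt) hK h.measurable h.bdd x
        t).hasDerivWithinAt)
      (fun t ht => by
        rw [norm_neg]
        exact hx' n t (by have := mem_Iio.1 ht; linarith))
      (mem_Iio.2 (by linarith)) (mem_Iio.2 (by linarith))
    simp only [timeAvg, setIntegral_timeMeasure, Real.norm_eq_abs] at hmv
    exact hmv
  obtain ⟨ℓ, hℓ, heq⟩ := hLip.extend_real
  refine ⟨ℓ, hℓ, ?_⟩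
  filter_upwards [hconv'] with t ht htT
  exact heq ⟨htT, ht⟩

/-- Integrate the Lipschitz bound from time `-T`, where the zero extension vanishes. Using `-T`
instead of `0` costs the factor `2` but needs no trace at time `0`. -/
theorem IsForcedSolution.ae_abs_le (h : IsForcedSolution T κ C M U u F w G) (hT : 0 < T)
    (hκ : 0 ≤ κ) (hC : 0 ≤ C) : ∀ᵐ p ∂(spaceTimeMeasure d T), |w p| ≤ C * (2 * T) := by
  have hm : MeasurableSet {p : ℝ × Torus d | |w (p.1, p.2)| ≤ C * (2 * T)} :=
    measurableSet_le (measurable_norm.comp h.measurable) measurable_const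
  rw [Measure.ae_prod_iff_ae_ae (p := fun p => |w p| ≤ C * (2 * T)) hm, Measure.ae_ae_comm
    (p := fun s x => |w (s, x)| ≤ C * (2 * T)) hm]
  filter_upwards [h.ae_exists_lipschitz hT hκ hC] with x hx
  obtain ⟨ℓ, hℓ, heq⟩ := hx
  have h0 : EqOn ℓ (fun _ => 0) (Iio 0) := by
    refine Measure.eqOn_open_of_ae_eq (μ := volume) ?_ isOpen_Iio hℓ.continuous.continuousOn
      continuousOn_const
    filter_upwards [ae_restrict_of_ae heq, ae_restrict_mem measurableSet_Iio] with t ht ht0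
    rw [← ht (lt_trans ht0 hT), indicator_of_notMem fun h' => lt_asymm ht0 h'.1]
  filter_upwards [ae_restrict_of_ae heq, ae_restrict_mem measurableSet_Ioo] with t ht htT
  have h2 := hℓ.dist_le_mul t (-T)
  rw [h0 (mem_Iio.2 (neg_lt_zero.2 hT)), ← ht htT.2, indicator_of_mem htT, Real.dist_eq,
    Real.dist_eq, sub_zero, Real.coe_toNNReal C hC] at h2
  refine h2.trans (mul_le_mul_of_nonneg_left ?_ hC)
  rw [abs_of_nonneg (by linarith [htT.1])]
  linarith [htT.2]

theorem IsForcedSolution.ae_abs_sub_le (h : IsForcedSolution T κ C M U u F w G) (hT : 0 < T)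
    (hκ : 0 ≤ κ) (hC : 0 ≤ C) {δ : ℝ} (hδ : 0 ≤ δ) :
    ∀ᵐ p ∂(spaceTimeMeasure d T), p.1 + δ < T → |w (p.1 + δ, p.2) - w p| ≤ C * δ := by
  have hm : MeasurableSet {p : ℝ × Torus d | p.1 + δ < T →
      |w (p.1 + δ, p.2) - w (p.1, p.2)| ≤ C * δ} := by
    have h1 : MeasurableSet {p : ℝ × Torus d | ¬p.1 + δ < T} :=
      (measurableSet_lt (measurable_fst.add_const δ) measurable_const).compl
    have h2 : MeasurableSet {p : ℝ × Torus d | |w (p.1 + δ, p.2) - w (p.1, p.2)| ≤ C * δ} :=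
      measurableSet_le (measurable_norm.comp
        ((h.measurable.comp (show Measurable fun p : ℝ × Torus d => (p.1 + δ, p.2) by
          fun_prop)).sub h.measurable)) measurable_const
    convert h1.union h2 using 1
    ext p
    simp only [mem_ofPred_eq, mem_union, imp_iff_not_or]
  rw [Measure.ae_prod_iff_ae_ae (p := fun p => p.1 + δ < T → |w (p.1 + δ, p.2) - w p| ≤ C * δ) hm,
    Measure.ae_ae_comm (p := fun s x => s + δ < T → |w (s + δ, x) - w (s, x)| ≤ C * δ) hm]
  filter_upwards [h.ae_exists_lipschitz hT hκ hC] with x hx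
  obtain ⟨ℓ, hℓ, heq⟩ := hx
  have heq' := (measurePreserving_add_right (volume : Measure ℝ) δ).quasiMeasurePreserving.ae heq
  filter_upwards [ae_restrict_of_ae heq, ae_restrict_of_ae heq', ae_restrict_mem measurableSet_Ioo]
    with t h1 h2 htT htδ
  rw [indicator_of_mem htT] at h1
  rw [indicator_of_mem (show t + δ ∈ Ioo 0 T from ⟨by linarith [htT.1], htδ⟩)] at h2
  have h3 := hℓ.dist_le_mul (t + δ) t
  rw [← h1 htT.2, ← h2 htδ, Real.dist_eq, Real.dist_eq, Real.coe_toNNReal C hC,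
    add_sub_cancel_left, abs_of_nonneg hδ] at h3
  exact h3

end Lipschitz

/-! ### Weak-* compactness in `L^∞` -/

section WeakStar

variable {α : Type*} [MeasurableSpace α] {μ : Measure α} {C : ℝ}

/-- Integration against a bounded function, as a functional on `L^1`. -/
theorem exists_L1_functional {f : α → ℝ} (hf : AEStronglyMeasurable f μ)
    (hC : ∀ᵐ x ∂μ, |f x| ≤ C) (hC0 : 0 ≤ C) :
    ∃ Λ : Lp ℝ 1 μ →L[ℝ] ℝ, ‖Λ‖ ≤ C ∧ ∀ φ : Lp ℝ 1 μ, Λ φ = ∫ x, f x * φ x ∂μ := by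
  have hi : ∀ φ : Lp ℝ 1 μ, Integrable (fun x => f x * φ x) μ := fun φ =>
    (L1.integrable_coeFn φ).bdd_mul (c := C) hf hC
  let Λ : Lp ℝ 1 μ →ₗ[ℝ] ℝ :=
    { toFun := fun φ => ∫ x, f x * φ x ∂μ
      map_add' := fun φ ψ => by
        rw [← integral_add (hi φ) (hi ψ)]
        refine integral_congr_ae ?_
        filter_upwards [Lp.coeFn_add φ ψ] with x hx
        rw [hx, Pi.add_apply, mul_add]
      map_smul' := fun c φ => by
        rw [RingHom.id_apply, smul_eq_mul, ← integral_const_mul]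
        refine integral_congr_ae ?_
        filter_upwards [Lp.coeFn_smul c φ] with x hx
        rw [hx, Pi.smul_apply, smul_eq_mul, mul_left_comm] }
  have hb : ∀ φ, ‖Λ φ‖ ≤ C * ‖φ‖ := fun φ => by
    rw [L1.norm_eq_integral_norm, ← integral_const_mul]
    refine norm_integral_le_of_norm_le ((L1.integrable_coeFn φ).norm.const_mul C) ?_
    filter_upwards [hC] with x hx
    rw [norm_mul]
    exact mul_le_mul_of_nonneg_right hx (norm_nonneg _)
  exact ⟨Λ.mkContinuous C hb, Λ.mkContinuous_norm_le hC0 hb, fun φ => rfl⟩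

/-- Every functional on `L^1` of a finite measure is integration against a bounded function. -/
theorem exists_bdd_repr_of_L1_functional [IsFiniteMeasure μ] (Λ : Lp ℝ 1 μ →L[ℝ] ℝ)
    (hΛ : ‖Λ‖ ≤ C) : ∃ f : α → ℝ, AEStronglyMeasurable f μ ∧ (∀ᵐ x ∂μ, |f x| ≤ C) ∧
      ∀ φ : Lp ℝ 1 μ, Λ φ = ∫ x, f x * φ x ∂μ := by
  have hC0 : 0 ≤ C := (norm_nonneg _).trans hΛ
  -- On a finite measure space `L²` embeds in `L¹`, so Riesz representation in `L²` supplies a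
  -- candidate density `f`.
  let ι : Lp ℝ 2 μ →ₗ[ℝ] Lp ℝ 1 μ :=
    { toFun := fun φ => ⟨φ.1, Lp.antitone one_le_two φ.2⟩
      map_add' := fun φ ψ => rfl
      map_smul' := fun c φ => rfl }
  have hι : ∀ φ, (ι φ : α → ℝ) = φ := fun φ => rfl
  have hιb : ∀ φ, ‖ι φ‖ ≤ (μ univ ^ (1 / (1 : ℝ≥0∞).toReal - 1 / (2 : ℝ≥0∞).toReal)).toReal * ‖φ‖ :=
    fun φ => by
      rw [Lp.norm_def, Lp.norm_def, hι, mul_comm, ← ENNReal.toReal_mul]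
      refine ENNReal.toReal_mono (ENNReal.mul_ne_top (Lp.eLpNorm_ne_top φ) ?_)
        (eLpNorm_le_eLpNorm_mul_rpow_measure_univ one_le_two (Lp.aestronglyMeasurable φ))
      exact (ENNReal.rpow_lt_top_of_nonneg (by norm_num) (measure_ne_top μ _)).ne
  let Λ₂ : StrongDual ℝ (Lp ℝ 2 μ) := Λ.comp (ι.mkContinuous _ hιb)
  let f := (InnerProductSpace.toDual ℝ (Lp ℝ 2 μ)).symm Λ₂
  have hfm : MemLp f 2 μ := Lp.memLp f
  have hfi : Integrable f μ := hfm.integrable one_le_two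
  have hrep : ∀ φ : Lp ℝ 2 μ, Λ (ι φ) = ∫ x, f x * φ x ∂μ := fun φ => by
    have h1 : inner ℝ f φ = Λ₂ φ := InnerProductSpace.toDual_symm_apply
    change Λ₂ φ = _
    rw [← h1, L2.inner_def]
    refine integral_congr_ae (ae_of_all _ fun x => ?_)
    simp [mul_comm]
  have hind : ∀ (c : ℝ) {s : Set α} (hs : MeasurableSet s),
      Λ (indicatorConstLp 1 hs (measure_ne_top μ s) c) = (∫ x in s, f x ∂μ) * c := by
    intro c s hs
    have h1 : ι (indicatorConstLp 2 hs (measure_ne_top μ s) c) =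
        indicatorConstLp 1 hs (measure_ne_top μ s) c := by
      refine Lp.ext ?_
      rw [hι]
      exact indicatorConstLp_coeFn.trans indicatorConstLp_coeFn.symm
    rw [← h1, hrep, ← integral_mul_const, ← integral_indicator hs]
    refine integral_congr_ae ?_
    filter_upwards [indicatorConstLp_coeFn (p := 2) (hs := hs) (hμs := measure_ne_top μ s) (c := c)]
      with x hx
    rw [hx]
    by_cases hxs : x ∈ s <;> simp [hxs]
  have hset : ∀ s, MeasurableSet s → |∫ x in s, f x ∂μ| ≤ C * μ.real s := fun s hs => by
    have h1 := Λ.le_opNorm (indicatorConstLp 1 hs (measure_ne_top μ s) 1)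
    rw [hind 1 hs, norm_indicatorConstLp one_ne_zero ENNReal.one_ne_top] at h1
    simp only [mul_one, Real.norm_eq_abs, abs_one, ENNReal.toReal_one, div_one, one_mul,
      Real.rpow_one] at h1
    exact h1.trans (mul_le_mul_of_nonneg_right hΛ measureReal_nonneg)
  -- Testing on indicators bounds the average of `f` over every set by `C`, hence `f` itself almost
  -- everywhere.
  have hfC : ∀ᵐ x ∂μ, |f x| ≤ C := by
    have h1 := ae_le_of_forall_setIntegral_le hfi (integrable_const C) fun s hs _ => by
      rw [setIntegral_const, smul_eq_mul, mul_comm]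
      exact (le_abs_self _).trans (hset s hs)
    have h2 := ae_le_of_forall_setIntegral_le (integrable_const (-C)) hfi fun s hs _ => by
      rw [setIntegral_const, smul_eq_mul, mul_comm, neg_mul]
      exact (abs_le.1 (hset s hs)).1
    filter_upwards [h1, h2] with x h3 h4
    exact abs_le.2 ⟨h4, h3⟩
  obtain ⟨Λ', -, hΛ'⟩ := exists_L1_functional hfi.1 hfC hC0
  refine ⟨f, hfi.1, hfC, fun φ => ?_⟩
  rw [← hΛ']
  -- The two functionals agree on indicators, whose span is dense in `L¹`, and both are continuous.
  induction φ using Lp.induction ENNReal.one_ne_top with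
  | indicatorConst c hs hμs =>
    rw [Lp.simpleFunc.coe_indicatorConst, hind, hΛ', ← integral_mul_const, ← integral_indicator hs]
    refine integral_congr_ae ?_
    filter_upwards [indicatorConstLp_coeFn (p := 1) (hs := hs) (hμs := hμs.ne) (c := c)]
      with x hx
    rw [hx]
    rename_i s
    by_cases hxs : x ∈ s <;> simp [hxs]
  | add hf hg _ h1 h2 => rw [map_add, map_add, h1, h2]
  | isClosed => exact isClosed_eq Λ.continuous Λ'.continuous

/-- Sequential Banach–Alaoglu in the dual of `L¹`, which is separable here, followed by representing
the limit functional by a bounded function. -/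
theorem exists_subseq_tendstoWeakStar [IsFiniteMeasure μ] [IsSeparable μ] {F : ℕ → α → ℝ}
    (hF : ∀ n, AEStronglyMeasurable (F n) μ) (hC : ∀ n, ∀ᵐ x ∂μ, |F n x| ≤ C) (hC0 : 0 ≤ C) :
    ∃ m : ℕ → ℕ, StrictMono m ∧ ∃ f : α → ℝ, (∀ᵐ x ∂μ, |f x| ≤ C) ∧
      TendstoWeakStar μ (fun n => F (m n)) f := by
  choose Λ hΛ hΛF using fun n => exists_L1_functional (hF n) (hC n) hC0
  have : Fact ((1 : ℝ≥0∞) ≠ (⊤ : ℝ≥0∞)) := ⟨ENNReal.one_ne_top⟩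
  obtain ⟨L, hL, m, hm, hlim⟩ := WeakDual.isSeqCompact_closedBall ℝ (Lp ℝ 1 μ) 0 C
    (x := fun n => StrongDual.toWeakDual (Λ n)) fun n => by simpa using hΛ n
  have hL' : ‖WeakDual.toStrongDual L‖ ≤ C := by simpa using hL
  obtain ⟨f, hf, hfC, hfL⟩ := exists_bdd_repr_of_L1_functional (WeakDual.toStrongDual L) hL'
  refine ⟨m, hm, f, hfC, fun n => MemLp.of_bound (hF _) C (hC _), MemLp.of_bound hf C hfC,
    fun ψ hψ => ?_⟩
  have h1 : Tendsto (fun n => Λ (m n) (hψ.toL1 ψ)) atTop (𝓝 (WeakDual.toStrongDual L (hψ.toL1 ψ))) :=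
    ((WeakDual.eval_continuous (hψ.toL1 ψ)).tendsto L).comp hlim
  have h2 : ∀ g : α → ℝ, ∫ x, g x * hψ.toL1 ψ x ∂μ = ∫ x, g x * ψ x ∂μ := fun g => by
    refine integral_congr_ae ?_
    filter_upwards [hψ.coeFn_toL1] with x hx
    rw [hx]
  simpa only [hΛF, hfL, h2] using h1

end WeakStar

/-! ### Test functions, difference quotients and weak time derivatives -/

theorem isOpenQuotientMap_prodMap_toTorus :
    IsOpenQuotientMap (fun p : ℝ × (Fin d → ℝ) => (p.1, toTorus p.2)) :=
  IsOpenQuotientMap.id.prodMap isOpenQuotientMap_toTorus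

section TestFunction

variable {I : Set ℝ} {φ : ℝ × Torus d → ℝ}

theorem IsTestFunction.continuous (h : IsTestFunction I φ) : Continuous φ :=
  isOpenQuotientMap_prodMap_toTorus.continuous_comp_iff.1 h.smooth.continuous

theorem IsTestFunction.hasDerivAt (h : IsTestFunction I φ) (t : ℝ) (x : Torus d) :
    HasDerivAt (fun s => φ (s, x)) (timeDeriv φ (t, x)) t := by
  obtain ⟨y, rfl⟩ := isOpenQuotientMap_toTorus.surjective x
  have h1 : ContDiff ℝ ∞ (fun s => φ (s, toTorus y)) :=
    h.smooth.comp (contDiff_id.prodMk contDiff_const)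
  exact (h1.differentiable (by simp) t).hasDerivAt

theorem IsTestFunction.continuous_timeDeriv (h : IsTestFunction I φ) :
    Continuous (timeDeriv φ) := by
  refine isOpenQuotientMap_prodMap_toTorus.continuous_comp_iff.1 ?_
  have h1 : (timeDeriv φ ∘ fun p : ℝ × (Fin d → ℝ) => (p.1, toTorus p.2)) =
      fun p => fderiv ℝ (fun p : ℝ × (Fin d → ℝ) => φ (p.1, toTorus p.2)) p (1, 0) := by
    ext p
    have h2 := (h.smooth.differentiable (by simp) p).hasFDerivAt
    have h3 : HasDerivAt (fun s : ℝ => (s, p.2)) ((1 : ℝ), (0 : Fin d → ℝ)) p.1 :=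
      (hasDerivAt_id p.1).prodMk (hasDerivAt_const p.1 p.2)
    exact (h2.comp_hasDerivAt p.1 h3).deriv
  rw [h1]
  exact (h.smooth.continuous_fderiv (by simp)).clm_apply continuous_const

theorem IsTestFunction.hasCompactSupport_timeDeriv (h : IsTestFunction I φ) :
    HasCompactSupport (timeDeriv φ) := by
  refine HasCompactSupport.of_support_subset_isCompact h.compact fun p hp => ?_
  by_contra hn
  refine hp ?_
  have h1 : φ =ᶠ[𝓝 p] 0 := notMem_tsupport_iff_eventuallyEq.1 hn
  have h2 : (fun s => φ (s, p.2)) =ᶠ[𝓝 p.1] fun _ => 0 := by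
    have : Tendsto (fun s : ℝ => (s, p.2)) (𝓝 p.1) (𝓝 p) :=
      (show Continuous fun s : ℝ => (s, p.2) by fun_prop).tendsto p.1
    exact this.eventually h1
  rw [timeDeriv, h2.deriv_eq, deriv_const]

theorem IsTestFunction.integrable (h : IsTestFunction I φ) (T : ℝ) :
    Integrable φ (spaceTimeMeasure d T) := by
  obtain ⟨K, hK⟩ := h.compact.exists_bound_of_continuous h.continuous
  exact Integrable.of_bound h.continuous.measurable.aestronglyMeasurable K (ae_of_all _ hK)

theorem IsTestFunction.exists_margin {T : ℝ} (h : IsTestFunction (Ioo 0 T) φ) :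
    ∃ ε > 0, ∀ p, φ p ≠ 0 → ∀ δ, 0 ≤ δ → δ ≤ ε → p.1 + δ < T := by
  have hK : IsCompact (Prod.fst '' tsupport φ) := h.compact.isCompact.image continuous_fst
  obtain ⟨ε, hε, hsub⟩ := hK.exists_cthickening_subset_open isOpen_Ioo
    (t := Ioo 0 T) (by rintro _ ⟨p, hp, rfl⟩; exact (h.support hp).1)
  refine ⟨ε, hε, fun p hp δ h0 hδ => (hsub ?_).2⟩
  refine Metric.mem_cthickening_of_dist_le (p.1 + δ) p.1 ε _
    ⟨p, subset_tsupport _ hp, rfl⟩ ?_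
  rw [Real.dist_eq, add_sub_cancel_left, abs_of_nonneg h0]
  exact hδ

end TestFunction

theorem spaceTimeMeasure_eq_restrict (T : ℝ) :
    spaceTimeMeasure d T = (volume : Measure (ℝ × Torus d)).restrict (Ioo 0 T ×ˢ univ) := by
  rw [Measure.volume_eq_prod, ← Measure.prod_restrict, Measure.restrict_univ]

instance (T : ℝ) : MeasureTheory.IsSeparable (spaceTimeMeasure d T) :=
  @instIsSeparableOfCountablyGeneratedOfSFinite _ _ _ inferInstance inferInstance

theorem measurePreserving_timeShift (δ : ℝ) : MeasurePreserving
    ((MeasurableEquiv.addRight δ).prodCongr (MeasurableEquiv.refl (Torus d))) volume volume :=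
  (measurePreserving_add_right (volume : Measure ℝ) δ).prod (MeasurePreserving.id volume)

/-- The forward difference quotient in time on `(0, T)`. -/
noncomputable def diffQuot (T δ : ℝ) (f : ℝ × Torus d → ℝ) (p : ℝ × Torus d) : ℝ :=
  {p : ℝ × Torus d | p.1 + δ < T}.indicator (fun p => (f (p.1 + δ, p.2) - f p) / δ) p

theorem measurable_diffQuot {T δ : ℝ} {f : ℝ × Torus d → ℝ} (hf : Measurable f) :
    Measurable (diffQuot T δ f) :=
  Measurable.indicator (((hf.comp (show Measurable fun p : ℝ × Torus d => (p.1 + δ, p.2) by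
    fun_prop)).sub hf).div_const δ) (measurableSet_lt (measurable_fst.add_const δ) measurable_const)

/-- Discrete integration by parts: extend `f` by zero, move the shift onto `φ`, and let the quotient
of `φ` converge by dominated convergence. For small `δ` the support margin of `φ` keeps both the
cutoff and the zero extension out of sight. -/
theorem tendsto_integral_diffQuot {T M : ℝ} {f : ℝ × Torus d → ℝ} (hf : Measurable f)
    (hM : ∀ p, |f p| ≤ M) {φ : ℝ × Torus d → ℝ} (hφ : IsTestFunction (Ioo 0 T) φ) {δ : ℕ → ℝ}
    (hδ0 : ∀ n, 0 < δ n) (hδ : Tendsto δ atTop (𝓝 0)) :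
    Tendsto (fun n => ∫ p, diffQuot T (δ n) f p * φ p ∂(spaceTimeMeasure d T)) atTop
      (𝓝 (-∫ p, f p * timeDeriv φ p ∂(spaceTimeMeasure d T))) := by
  obtain ⟨ε, hε, hmar⟩ := hφ.exists_margin
  obtain ⟨K, hK⟩ := hφ.hasCompactSupport_timeDeriv.exists_bound_of_continuous
    hφ.continuous_timeDeriv
  have hS : MeasurableSet (Ioo 0 T ×ˢ univ : Set (ℝ × Torus d)) :=
    measurableSet_Ioo.prod MeasurableSet.univ
  set g : ℝ × Torus d → ℝ := (Ioo 0 T ×ˢ univ).indicator f with hg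
  have hgm : Measurable g := hf.indicator hS
  have hgi : Integrable g volume := by
    rw [hg, integrable_indicator_iff hS, IntegrableOn, ← spaceTimeMeasure_eq_restrict]
    exact Integrable.of_bound hf.aestronglyMeasurable M (ae_of_all _ hM)
  have hlim : Tendsto (fun n => ∫ p, g p * ((φ (p.1 - δ n, p.2) - φ p) / δ n)) atTop
      (𝓝 (∫ p, g p * -timeDeriv φ p)) := by
    refine tendsto_integral_of_dominated_convergence (fun p => |g p| * K) (fun n => ?_)
      (hgi.abs.mul_const K) (fun n => ae_of_all _ fun p => ?_) (ae_of_all _ fun p => ?_)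
    · have := hφ.continuous.comp (show Continuous fun p : ℝ × Torus d => (p.1 - δ n, p.2) by
        fun_prop)
      exact (hgm.mul ((this.measurable.sub hφ.continuous.measurable).div_const _)).aestronglyMeasurable
    · rw [norm_mul]
      refine mul_le_mul_of_nonneg_left ?_ (abs_nonneg _)
      have := convex_univ.norm_image_sub_le_of_norm_hasDerivWithin_le
        (f := fun s => φ (s, p.2)) (f' := fun s => timeDeriv φ (s, p.2)) (C := K) (x := p.1)
        (y := p.1 - δ n) (fun s _ => (hφ.hasDerivAt s p.2).hasDerivWithinAt) (fun s _ => hK _)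
        trivial trivial
      rw [sub_sub_cancel_left, norm_neg, Real.norm_of_nonneg (hδ0 n).le] at this
      rw [norm_div, Real.norm_of_nonneg (hδ0 n).le]
      exact (div_le_iff₀ (hδ0 n)).2 this
    · refine Tendsto.const_mul _ ?_
      have h1 := (hφ.hasDerivAt p.1 p.2).tendsto_slope_zero
      have h2 : Tendsto (fun n => -δ n) atTop (𝓝[≠] 0) := by
        refine tendsto_nhdsWithin_iff.2 ⟨by simpa using hδ.neg, Eventually.of_forall fun n => ?_⟩
        exact neg_ne_zero.2 (hδ0 n).ne'
      refine ((h1.comp h2).neg).congr fun n => ?_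
      simp only [Function.comp, smul_eq_mul, ← sub_eq_add_neg]
      rw [inv_neg, neg_mul, neg_neg, div_eq_inv_mul]
  have hend : ∫ p, g p * -timeDeriv φ p =
      -∫ p, f p * timeDeriv φ p ∂(spaceTimeMeasure d T) := by
    rw [spaceTimeMeasure_eq_restrict, ← integral_indicator hS, ← integral_neg]
    refine integral_congr_ae (ae_of_all _ fun p => ?_)
    by_cases hp : p ∈ (Ioo 0 T ×ˢ univ : Set (ℝ × Torus d)) <;> simp [hg, hp]
  rw [← hend]
  refine hlim.congr' ?_
  filter_upwards [hδ.eventually_le_const hε] with n hn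
  have i1 : Integrable (fun p => g p * φ p) volume := by
    obtain ⟨R, hR⟩ := hφ.compact.exists_bound_of_continuous hφ.continuous
    exact hgi.mul_bdd (c := R) hφ.continuous.measurable.aestronglyMeasurable (ae_of_all _ hR)
  have i2 : Integrable (fun p : ℝ × Torus d => g p * φ (p.1 - δ n, p.2)) volume := by
    obtain ⟨R, hR⟩ := hφ.compact.exists_bound_of_continuous hφ.continuous
    have := hφ.continuous.comp (show Continuous fun p : ℝ × Torus d => (p.1 - δ n, p.2) by
        fun_prop)
    exact hgi.mul_bdd (c := R) this.measurable.aestronglyMeasurable (ae_of_all _ fun p => hR _)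
  have e0 : ∫ p : ℝ × Torus d, g p * φ (p.1 - δ n, p.2) =
      ∫ p : ℝ × Torus d, g (p.1 + δ n, p.2) * φ p := by
    rw [← (measurePreserving_timeShift (δ n)).integral_comp']
    refine integral_congr_ae (ae_of_all _ fun p => ?_)
    simp [MeasurableEquiv.prodCongr]
    exact Or.inl rfl
  have i3 : Integrable (fun p : ℝ × Torus d => g (p.1 + δ n, p.2) * φ p) volume := by
    refine ((measurePreserving_timeShift (δ n)).integrable_comp_of_integrable i2).congr
      (ae_of_all _ fun p => ?_)
    simp [MeasurableEquiv.prodCongr]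
    exact Or.inl rfl
  calc ∫ p, g p * ((φ (p.1 - δ n, p.2) - φ p) / δ n)
      = ((∫ p : ℝ × Torus d, g p * φ (p.1 - δ n, p.2)) - ∫ p, g p * φ p) / δ n := by
        rw [← integral_sub i2 i1, ← integral_div]
        refine integral_congr_ae (ae_of_all _ fun p => ?_)
        dsimp only
        ring
    _ = ∫ p : ℝ × Torus d, (g (p.1 + δ n, p.2) - g p) / δ n * φ p := by
        rw [e0, ← integral_sub i3 i1, ← integral_div]
        refine integral_congr_ae (ae_of_all _ fun p => ?_)
        dsimp only
        ring
    _ = ∫ p, diffQuot T (δ n) f p * φ p ∂(spaceTimeMeasure d T) := by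
        rw [spaceTimeMeasure_eq_restrict, ← integral_indicator hS]
        refine integral_congr_ae (ae_of_all _ fun p => ?_)
        by_cases hp : φ p = 0
        · simp only [hp, mul_zero]
          by_cases hp' : p ∈ (Ioo 0 T ×ˢ univ : Set (ℝ × Torus d)) <;> simp [hp, hp']
        · have h1 : p ∈ (Ioo 0 T ×ˢ univ : Set (ℝ × Torus d)) :=
            hφ.support (subset_tsupport _ hp)
          have h2 := hmar p hp (δ n) (hδ0 n).le hn
          have h3 : (p.1 + δ n, p.2) ∈ (Ioo 0 T ×ˢ univ : Set (ℝ × Torus d)) :=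
            ⟨⟨by linarith [h1.1.1, hδ0 n], h2⟩, trivial⟩
          dsimp only
          rw [indicator_of_mem h1, hg, indicator_of_mem h1, indicator_of_mem h3, diffQuot,
            indicator_of_mem (by exact h2)]

/-- A bounded function that is Lipschitz in time has a bounded weak time derivative. -/
theorem exists_hasWeakTimeDeriv {T C M : ℝ} (hC : 0 ≤ C) {f : ℝ × Torus d → ℝ}
    (hf : Measurable f) (hM : ∀ p, |f p| ≤ M)
    (hL : ∀ δ, 0 ≤ δ → ∀ᵐ p ∂(spaceTimeMeasure d T), p.1 + δ < T →
      |f (p.1 + δ, p.2) - f p| ≤ C * δ) :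
    ∃ g : ℝ × Torus d → ℝ, HasWeakTimeDeriv T f g ∧ MemLp g ∞ (spaceTimeMeasure d T) ∧
      ∀ᵐ p ∂(spaceTimeMeasure d T), |g p| ≤ C := by
  set δ : ℕ → ℝ := fun n => 1 / ((n : ℝ) + 1)
  have hδ0 : ∀ n, 0 < δ n := fun n => Nat.one_div_pos_of_nat
  have hδ : Tendsto δ atTop (𝓝 0) := tendsto_one_div_add_atTop_nhds_zero_nat
  have hb : ∀ n, ∀ᵐ p ∂(spaceTimeMeasure d T), |diffQuot T (δ n) f p| ≤ C := fun n => by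
    filter_upwards [hL (δ n) (hδ0 n).le] with p hp
    by_cases h : p.1 + δ n < T
    · rw [diffQuot, indicator_of_mem (by exact h), abs_div, abs_of_pos (hδ0 n)]
      exact (div_le_iff₀ (hδ0 n)).2 (hp h)
    · rw [diffQuot, indicator_of_notMem (by exact h), abs_zero]
      exact hC
  -- The derivative is a weak-* limit of the difference quotients, which are bounded by `C`; the
  -- bound passes to the limit.
  obtain ⟨m, hm, g, hgC, hg⟩ := exists_subseq_tendstoWeakStar (μ := spaceTimeMeasure d T)
    (fun n => (measurable_diffQuot hf).aestronglyMeasurable) hb hC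
  refine ⟨g, fun φ hφ => ?_, hg.2.1, hgC⟩
  have h1 := hg.2.2 φ (hφ.integrable T)
  have h2 := (tendsto_integral_diffQuot hf hM hφ hδ0 hδ).comp hm.tendsto_atTop
  rw [← tendsto_nhds_unique h2 h1, neg_neg]

/-! ### Lipschitz representatives, weak-* limits and the energy -/

instance : IsProbabilityMeasure (volume : Measure (Torus d)) :=
  ⟨by simp [volume_pi, Measure.pi_univ]⟩

theorem HasWeakTimeDeriv.congr_ae {T : ℝ} {f f' g : ℝ × Torus d → ℝ}
    (h : HasWeakTimeDeriv T f g) (hf : f' =ᵐ[spaceTimeMeasure d T] f) :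
    HasWeakTimeDeriv T f' g := fun φ hφ => by
  rw [← h φ hφ]
  refine integral_congr_ae ?_
  filter_upwards [hf] with p hp
  rw [hp]

theorem lipschitzConst_nonneg (u : Torus d → EuclideanSpace ℝ (Fin d)) (θ₀ : Torus d → ℝ) :
    0 ≤ (eLpNorm u ∞ volume).toReal * normC1 θ₀ + normC2 θ₀ := by
  have h1 : 0 ≤ normC1 θ₀ :=
    add_nonneg (supNorm_nonneg _) (Finset.sum_nonneg fun _ _ => supNorm_nonneg _)
  have h2 : 0 ≤ normC2 θ₀ := add_nonneg h1
    (Finset.sum_nonneg fun _ _ => Finset.sum_nonneg fun _ _ => supNorm_nonneg _)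
  have := ENNReal.toReal_nonneg (a := eLpNorm u ∞ volume)
  positivity

/-- A weak solution has a bounded measurable representative that is Lipschitz in time, with the
constant of the uniform bound on the time derivative. -/
theorem IsWeakSolution.exists_lipschitz_representative {T κ : ℝ} (hT : 0 < T)
    (hκ : κ ∈ Ioo (0 : ℝ) 1) {u : Torus d → EuclideanSpace ℝ (Fin d)} (hu : MemLp u ∞ volume)
    (hdiv : IsDivFree u) {θ₀ : Torus d → ℝ} (hθ₀ : TorusContDiff 2 θ₀)
    {θ : ℝ × Torus d → ℝ} {G : ℝ × Torus d → EuclideanSpace ℝ (Fin d)}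
    (h : IsWeakSolution T u κ θ₀ θ G) :
    ∃ (M : ℝ) (f : ℝ × Torus d → ℝ), Measurable f ∧ (∀ p, |f p| ≤ M) ∧
      θ =ᵐ[spaceTimeMeasure d T] f ∧
      ∀ δ, 0 ≤ δ → ∀ᵐ p ∂(spaceTimeMeasure d T), p.1 + δ < T →
        |f (p.1 + δ, p.2) - f p| ≤
          ((eLpNorm u ∞ volume).toReal * normC1 θ₀ + normC2 θ₀) * δ := by
  obtain ⟨M, w, g, hw, hθ, -⟩ := h.exists_isForcedSolution hT hκ hu hdiv hθ₀
  have c0 := hθ₀.continuous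
  refine ⟨M + supNorm θ₀, fun p => w p + θ₀ p.2,
    hw.measurable.add (c0.comp continuous_snd).measurable,
    fun p => (abs_add_le _ _).trans (add_le_add (hw.bdd p) (abs_le_supNorm c0 _)), hθ,
    fun δ hδ => ?_⟩
  filter_upwards [hw.ae_abs_sub_le hT hκ.1.le (lipschitzConst_nonneg u θ₀) hδ] with p hp hpT
  rw [add_sub_add_right_eq_sub]
  exact hp hpT

theorem setIntegral_timeShift {T δ : ℝ} (hδ : 0 ≤ δ) {A : Set (ℝ × Torus d)}
    (hA : A ⊆ {p | p.1 + δ < T} ∩ Ioo 0 T ×ˢ univ) (f : ℝ × Torus d → ℝ) :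
    ∫ p in A, f (p.1 + δ, p.2) ∂(spaceTimeMeasure d T) =
      ∫ p in {p | (p.1 - δ, p.2) ∈ A}, f p ∂(spaceTimeMeasure d T) := by
  have hB : {p : ℝ × Torus d | (p.1 - δ, p.2) ∈ A} ⊆ Ioo 0 T ×ˢ univ := fun p hp => by
    obtain ⟨h1, h2, -⟩ := hA hp
    simp only [mem_ofPred_eq, sub_add_cancel] at h1
    exact ⟨⟨by linarith [h2.1], h1⟩, trivial⟩
  have key := (measurePreserving_timeShift (d := d) δ).setIntegral_preimage_emb
    (MeasurableEquiv.measurableEmbedding _) f {p : ℝ × Torus d | (p.1 - δ, p.2) ∈ A}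
  have hpre : ((MeasurableEquiv.addRight δ).prodCongr (MeasurableEquiv.refl (Torus d))) ⁻¹'
      {p : ℝ × Torus d | (p.1 - δ, p.2) ∈ A} = A := by
    ext p
    change ((p.1 + δ - δ, p.2) ∈ A) ↔ p ∈ A
    rw [add_sub_cancel_right]
  rw [hpre] at key
  rw [spaceTimeMeasure_eq_restrict, Measure.restrict_restrict_of_subset hB,
    Measure.restrict_restrict_of_subset (hA.trans inter_subset_right), ← key]
  rfl

/-- After a change of variables, the integral of a time increment over a set is a pairing with a
difference of two indicators, which is an `L¹` function. So bounds on these averages pass to the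
limit, and averages over all sets determine the pointwise bound. -/
theorem TendstoWeakStar.ae_abs_sub_le {T C M δ : ℝ} (hδ : 0 ≤ δ) {f : ℕ → ℝ × Torus d → ℝ}
    {g : ℝ × Torus d → ℝ} (hfg : TendstoWeakStar (spaceTimeMeasure d T) f g)
    (hf : ∀ n, Measurable (f n)) (hfb : ∀ n, ∃ M, ∀ p, |f n p| ≤ M)
    (hL : ∀ n, ∀ᵐ p ∂(spaceTimeMeasure d T), p.1 + δ < T →
      |f n (p.1 + δ, p.2) - f n p| ≤ C * δ)
    (hg : Measurable g) (hgM : ∀ p, |g p| ≤ M) :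
    ∀ᵐ p ∂(spaceTimeMeasure d T), p.1 + δ < T → |g (p.1 + δ, p.2) - g p| ≤ C * δ := by
  set μ := spaceTimeMeasure d T with hμ
  set S : Set (ℝ × Torus d) := {p | p.1 + δ < T} with hSdef
  have hS : MeasurableSet S := measurableSet_lt (measurable_fst.add_const δ) measurable_const
  have hI : MeasurableSet (Ioo 0 T ×ˢ univ : Set (ℝ × Torus d)) :=
    measurableSet_Ioo.prod MeasurableSet.univ
  have shift : Measurable fun p : ℝ × Torus d => (p.1 + δ, p.2) := by fun_prop
  have shift' : Measurable fun p : ℝ × Torus d => (p.1 - δ, p.2) := by fun_prop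
  have int : ∀ {f : ℝ × Torus d → ℝ} {M : ℝ}, Measurable f → (∀ p, |f p| ≤ M) →
      Integrable f μ := fun hf hM =>
    Integrable.of_bound hf.aestronglyMeasurable _ (ae_of_all _ hM)
  have hset : ∀ s, MeasurableSet s → ∀ {f : ℝ × Torus d → ℝ} {M : ℝ}, Measurable f →
      (∀ p, |f p| ≤ M) →
      ∫ p in s, (f (p.1 + δ, p.2) - f p) ∂(μ.restrict S) =
        ∫ p, f p * (({p : ℝ × Torus d | (p.1 - δ, p.2) ∈ s ∩ S ∩ Ioo 0 T ×ˢ univ}.indicator 1 p) -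
          ((s ∩ S ∩ Ioo 0 T ×ˢ univ).indicator 1 p)) ∂μ := by
    intro s hs f M hf hM
    have hA : MeasurableSet (s ∩ S ∩ Ioo 0 T ×ˢ univ) := (hs.inter hS).inter hI
    have e1 : (μ.restrict S).restrict s = μ.restrict (s ∩ S ∩ Ioo 0 T ×ˢ univ) := by
      rw [Measure.restrict_restrict hs, hμ, spaceTimeMeasure_eq_restrict,
        Measure.restrict_restrict (hs.inter hS), Measure.restrict_restrict hA,
        inter_assoc (s ∩ S), inter_self]
    have i1 := int hf hM
    have i2 : Integrable (fun p : ℝ × Torus d => f (p.1 + δ, p.2)) μ :=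
      int (hf.comp shift) fun p => hM _
    have hB : MeasurableSet {p : ℝ × Torus d | (p.1 - δ, p.2) ∈ s ∩ S ∩ Ioo 0 T ×ˢ univ} :=
      shift' hA
    rw [e1, integral_sub i2.integrableOn i1.integrableOn,
      setIntegral_timeShift hδ (inter_subset_inter_left _ inter_subset_right) f,
      ← integral_indicator hA, ← integral_indicator hB,
      ← integral_sub (i1.indicator hB) (i1.indicator hA)]
    refine integral_congr_ae (ae_of_all _ fun p => ?_)
    simp only [indicator, Pi.one_apply, mul_sub, mul_ite, mul_one, mul_zero, mem_ofPred_eq]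
  have hbound : ∀ s, MeasurableSet s →
      |∫ p in s, (g (p.1 + δ, p.2) - g p) ∂(μ.restrict S)| ≤ (μ.restrict S).real s * (C * δ) := by
    intro s hs
    have hA : MeasurableSet (s ∩ S ∩ Ioo 0 T ×ˢ univ) := (hs.inter hS).inter hI
    have hψ : Integrable (fun p : ℝ × Torus d =>
        ({p : ℝ × Torus d | (p.1 - δ, p.2) ∈ s ∩ S ∩ Ioo 0 T ×ˢ univ}.indicator 1 p : ℝ) -
          ((s ∩ S ∩ Ioo 0 T ×ˢ univ).indicator 1 p)) μ :=
      ((integrable_const 1).indicator (shift' hA)).sub ((integrable_const 1).indicator hA)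
    have hlim := hfg.2.2 _ hψ
    rw [← hset s hs hg hgM] at hlim
    refine le_of_tendsto hlim.abs (Eventually.of_forall fun n => ?_)
    obtain ⟨K, hK⟩ := hfb n
    rw [← hset s hs (hf n) hK]
    rw [mul_comm]
    exact norm_setIntegral_le_of_norm_le_const_ae' (μ := μ.restrict S) (C := C * δ)
      (f := fun p : ℝ × Torus d => f n (p.1 + δ, p.2) - f n p) (measure_lt_top _ _)
      (((ae_restrict_iff' hS).2 (hL n)).mono fun p hp _ => hp)
  have hi : Integrable (fun p : ℝ × Torus d => g (p.1 + δ, p.2) - g p) (μ.restrict S) :=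
    ((int (hg.comp shift) fun p => hgM _).sub (int hg hgM)).integrableOn
  refine (ae_restrict_iff' hS).1 ?_
  have h1 := ae_le_of_forall_setIntegral_le hi (integrable_const (C * δ)) fun s hs _ => by
    rw [setIntegral_const, smul_eq_mul]
    exact (le_abs_self _).trans (hbound s hs)
  have h2 := ae_le_of_forall_setIntegral_le (integrable_const (-(C * δ))) hi fun s hs _ => by
    rw [setIntegral_const, smul_eq_mul, mul_neg]
    exact (abs_le.1 (hbound s hs)).1
  filter_upwards [h1, h2] with p h3 h4
  exact abs_le.2 ⟨h4, h3⟩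

/-- View `e` as a function on space-time, constant in `x`, take its bounded weak time derivative
there and average it over the torus, which has mass one. The dimension is auxiliary. -/
theorem memW1Infty_of_lipschitz (d : ℕ) {T C M : ℝ} (hC : 0 ≤ C) {e : ℝ → ℝ} (he : Measurable e)
    (hM : ∀ t, |e t| ≤ M)
    (hL : ∀ δ, 0 ≤ δ → ∀ᵐ t ∂(timeMeasure T), t + δ < T → |e (t + δ) - e t| ≤ C * δ) :
    MemW1Infty T e := by
  obtain ⟨g, hg, hgL, hgC⟩ := exists_hasWeakTimeDeriv (d := d) (f := fun p => e p.1) hC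
    (he.comp measurable_fst) (fun p => hM _) fun δ hδ =>
      Measure.quasiMeasurePreserving_fst.ae (hL δ hδ)
  have hgi : Integrable g (spaceTimeMeasure d T) := hgL.integrable le_top
  refine ⟨MemLp.of_bound he.aestronglyMeasurable M (ae_of_all _ hM), fun t => ∫ x, g (t, x),
    MemLp.of_bound hgL.1.integral_prod_right' C ?_, fun φ hφ hc hs => ?_⟩
  · filter_upwards [Measure.ae_ae_of_ae_prod hgC] with t ht
    simpa using norm_integral_le_of_norm_le_const (f := fun x => g (t, x)) (C := C) ht
  · obtain ⟨K, hK⟩ := hc.exists_bound_of_continuous hφ.continuous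
    have h := hg _ (isTestFunction_mul hφ hc hs (torusContDiff_const 1))
    have hd : ∀ p : ℝ × Torus d, timeDeriv (fun p => φ p.1 * 1) p = deriv φ p.1 * 1 :=
      timeDeriv_mul φ fun _ => 1
    simp only [hd] at h
    simp only [mul_one] at h
    have e1 := integral_integral_mul (p := fun _ => 1) (P := 1) hφ.continuous hK hgi
      aestronglyMeasurable_const (ae_of_all _ fun _ => by simp)
    have e2 : ∫ p, e p.1 * deriv φ p.1 ∂(spaceTimeMeasure d T) =
        ∫ t, e t * deriv φ t ∂(timeMeasure T) := by
      simpa using integral_prod_mul (μ := timeMeasure T) (ν := (volume : Measure (Torus d)))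
        (fun t => e t * deriv φ t) (fun _ => (1 : ℝ))
    rw [← e2, h]
    simp only [mul_one] at e1
    simp only [mul_comm _ (φ _)]
    rw [e1]

theorem MemW1Infty.congr_ae {T : ℝ} {e f : ℝ → ℝ} (h : MemW1Infty T e)
    (hf : f =ᵐ[timeMeasure T] e) : MemW1Infty T f := by
  obtain ⟨h1, e', h2, h3⟩ := h
  refine ⟨(memLp_congr_ae hf).2 h1, e', h2, fun φ hφ hc hs => ?_⟩
  rw [← h3 φ hφ hc hs]
  refine integral_congr_ae ?_
  filter_upwards [hf] with t ht
  rw [ht]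

/-- From `a² - b² = (a + b)(a - b)`, the energy has Lipschitz constant `2 M C`. -/
theorem memW1Infty_energy {T C M : ℝ} (hC : 0 ≤ C) {f : ℝ × Torus d → ℝ} (hf : Measurable f)
    (hM : ∀ p, |f p| ≤ M)
    (hL : ∀ δ, 0 ≤ δ → ∀ᵐ p ∂(spaceTimeMeasure d T), p.1 + δ < T →
      |f (p.1 + δ, p.2) - f p| ≤ C * δ) :
    MemW1Infty T (fun t => ∫ x, f (t, x) ^ 2) := by
  have hM0 : 0 ≤ M := (abs_nonneg _).trans (hM (0, 0))
  have hsq : ∀ p, |f p ^ 2| ≤ M ^ 2 := fun p => by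
    rw [abs_pow]
    exact pow_le_pow_left₀ (abs_nonneg _) (hM p) 2
  have hi : ∀ t, Integrable (fun x => f (t, x) ^ 2) volume := fun t =>
    Integrable.of_bound ((hf.comp measurable_prodMk_left).pow_const 2).aestronglyMeasurable (M ^ 2)
      (ae_of_all _ fun x => hsq _)
  refine memW1Infty_of_lipschitz d (C := C * (2 * M)) (M := M ^ 2) (by positivity)
    (StronglyMeasurable.integral_prod_right' (hf.pow_const 2).stronglyMeasurable).measurable
    (fun t => by
      simpa using norm_integral_le_of_norm_le_const (μ := (volume : Measure (Torus d)))
        (f := fun x => f (t, x) ^ 2) (C := M ^ 2) (ae_of_all _ fun x => hsq (t, x))) fun δ hδ => ?_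
  filter_upwards [Measure.ae_ae_of_ae_prod (hL δ hδ)] with t ht htT
  rw [← integral_sub (hi _) (hi _)]
  have := norm_integral_le_of_norm_le_const (μ := (volume : Measure (Torus d)))
    (f := fun x => f (t + δ, x) ^ 2 - f (t, x) ^ 2) (C := C * δ * (2 * M)) ?_
  · rw [mul_right_comm]
    simpa using this
  · filter_upwards [ht] with x hx
    have h1 := hx htT
    rw [Real.norm_eq_abs, sq_sub_sq, abs_mul, mul_comm]
    refine mul_le_mul h1 ?_ (abs_nonneg _) ((abs_nonneg _).trans h1)
    exact (abs_add_le _ _).trans (by linarith [hM (t + δ, x), hM (t, x)])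

/-! ### Bound on the dissipation at almost every time -/

/-- Fatou's lemma for the squares. -/
theorem integral_sq_le_of_tendsto {α : Type*} [MeasurableSpace α] {μ : Measure α}
    {f : ℕ → α → ℝ} {g : α → ℝ} {R : ℝ} (hf : ∀ n, Measurable (f n)) (hg : Measurable g)
    (hlim : ∀ᵐ x ∂μ, Tendsto (fun n => f n x) atTop (𝓝 (g x)))
    (hR : ∀ᶠ n in atTop, MemLp (f n) 2 μ ∧ ∫ x, f n x ^ 2 ∂μ ≤ R) : ∫ x, g x ^ 2 ∂μ ≤ R := by
  obtain ⟨n₀, hn₀⟩ := hR.exists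
  have hR0 : 0 ≤ R := (integral_nonneg fun x => sq_nonneg (f n₀ x)).trans hn₀.2
  have h1 : ∫⁻ x, ENNReal.ofReal (g x ^ 2) ∂μ =
      ∫⁻ x, liminf (fun n => ENNReal.ofReal (f n x ^ 2)) atTop ∂μ := by
    refine lintegral_congr_ae ?_
    filter_upwards [hlim] with x hx
    exact (ENNReal.tendsto_ofReal (hx.pow 2)).liminf_eq.symm
  have h2 : ∫⁻ x, ENNReal.ofReal (g x ^ 2) ∂μ ≤ ENNReal.ofReal R := by
    rw [h1]
    refine (lintegral_liminf_le fun n => ((hf n).pow_const 2).ennreal_ofReal).trans ?_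
    refine liminf_le_of_frequently_le' (hR.mono fun n hn => ?_).frequently
    rw [← ofReal_integral_eq_lintegral_ofReal hn.1.integrable_sq (ae_of_all _ fun x => sq_nonneg _)]
    exact ENNReal.ofReal_le_ofReal hn.2
  rw [integral_eq_lintegral_of_nonneg_ae (ae_of_all _ fun x => sq_nonneg _)
    (hg.pow_const 2).aestronglyMeasurable]
  exact ENNReal.toReal_le_of_le_ofReal hR0 h2

section EnergyEstimate

variable {T κ C M U : ℝ} {u : Fin d → Torus d → ℝ} {F : Torus d → ℝ}
  {w : ℝ × Torus d → ℝ} {G : Fin d → ℝ × Torus d → ℝ}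

theorem IsForcedSolution.abs_timeAvg_le (h : IsForcedSolution T κ C M U u F w G) (hT : 0 < T)
    (hκ : 0 ≤ κ) (hC : 0 ≤ C) {ζ : ℝ → ℝ} (hζ : Continuous ζ) (hζ0 : ∀ s, 0 ≤ ζ s) :
    ∀ᵐ x, |timeAvg T ζ w x| ≤ (∫ s, ζ s ∂(timeMeasure T)) * (C * (2 * T)) := by
  have hm : MeasurableSet {p : ℝ × Torus d | |w (p.1, p.2)| ≤ C * (2 * T)} :=
    measurableSet_le (measurable_norm.comp h.measurable) measurable_const
  have h1 := Measure.ae_ae_of_ae_prod (h.ae_abs_le hT hκ hC)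
  rw [Measure.ae_ae_comm (p := fun s x => |w (s, x)| ≤ C * (2 * T)) hm] at h1
  filter_upwards [h1] with x hx
  rw [← integral_mul_const]
  refine norm_integral_le_of_norm_le (f := fun s => ζ s * w (s, x))
    ((integrable_timeMeasure hζ).mul_const _) ?_
  filter_upwards [hx] with s hs
  rw [norm_mul, Real.norm_of_nonneg (hζ0 s)]
  exact mul_le_mul_of_nonneg_left hs (hζ0 s)

/-- Test the averaged equation with its own solution `V` (`b = id`, `m = L = 1`). Since `|V| ≤ 2CT`,
while `∂_t V` and the averaged forcing are at most `C`, each of the two remaining terms is at most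
`2C²T`. The bound does not depend on how concentrated the weight is. -/
theorem IsForcedSolution.sum_integral_timeAvg_grad_sq_le (h : IsForcedSolution T κ C M U u F w G)
    (hT : 0 < T) (hκ : 0 ≤ κ) (hC : 0 ≤ C) {ζ : ℝ → ℝ} (hζ : ContDiff ℝ ∞ ζ)
    (hζc : HasCompactSupport ζ) (hζs : tsupport ζ ⊆ Iio T) (hζ0 : ∀ s, 0 ≤ ζ s)
    (hζ1 : ∫ s, ζ s ∂(timeMeasure T) ≤ 1) :
    κ * ∑ i, ∫ x, timeAvg T ζ (G i) x ^ 2 ≤ 4 * C ^ 2 * T := by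
  have hI0 : 0 ≤ ∫ s, ζ s ∂(timeMeasure T) := integral_nonneg hζ0
  have hCT : 0 ≤ C * (2 * T) := by positivity
  have key := h.renormalized hT.le hκ hζ hζc hζs 0 (b := fun s => s) (b' := fun _ => 1) (m := 1)
    (L := 1) contDiff_id (fun s => hasDerivAt_id s) zero_le_one (fun _ => le_rfl) fun _ => le_rfl
  have hV : ∀ᵐ x, |timeAvg T ζ w x| ≤ C * (2 * T) := by
    filter_upwards [h.abs_timeAvg_le hT hκ hC hζ.continuous hζ0] with x hx
    exact hx.trans (mul_le_of_le_one_left hCT hζ1)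
  have b1 : |∫ x, -timeAvg T (deriv ζ) w x * (timeAvg T ζ w x - 0)| ≤ C * (C * (2 * T)) := by
    have := norm_integral_le_of_norm_le_const (μ := (volume : Measure (Torus d)))
      (f := fun x => -timeAvg T (deriv ζ) w x * (timeAvg T ζ w x - 0)) (C := C * (C * (2 * T))) ?_
    · simpa using this
    · filter_upwards [hV, h.abs_timeAvg_deriv_le hT hκ hC hζ hζc hζs hζ0] with x h1 h2
      rw [norm_mul, norm_neg, sub_zero]
      exact mul_le_mul (h2.trans (mul_le_of_le_one_right hC hζ1)) h1 (abs_nonneg _) hC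
  have b2 : |∫ x, (-(∫ s, ζ s ∂(timeMeasure T)) * F x) * (timeAvg T ζ w x - 0)| ≤
      C * (C * (2 * T)) := by
    have := norm_integral_le_of_norm_le_const (μ := (volume : Measure (Torus d)))
      (f := fun x => (-(∫ s, ζ s ∂(timeMeasure T)) * F x) * (timeAvg T ζ w x - 0))
      (C := C * (C * (2 * T))) ?_
    · simpa using this
    · filter_upwards [hV, h.forcing_bdd] with x h1 h2
      rw [norm_mul, norm_mul, norm_neg, sub_zero, Real.norm_of_nonneg hI0]
      refine mul_le_mul ?_ h1 (abs_nonneg _) hC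
      exact (mul_le_of_le_one_left (abs_nonneg _) hζ1).trans h2
  simp only [one_mul, ← sq] at key
  have h1 := (abs_le.1 b1).1
  have h2 := (abs_le.1 b2).2
  nlinarith

theorem measurable_timeAvg_comp_sub {T : ℝ} {ζ : ℝ → ℝ} {g : ℝ × Torus d → ℝ} (hζ : Continuous ζ)
    (hg : Measurable g) :
    Measurable fun p : ℝ × Torus d => timeAvg T (fun s => ζ (s - p.1)) g p.2 := by
  have : Measurable fun q : ℝ × (ℝ × Torus d) => ζ (q.1 - q.2.1) * g (q.1, q.2.2) :=
    (hζ.measurable.comp (by fun_prop)).mul (hg.comp (by fun_prop))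
  exact (StronglyMeasurable.integral_prod_left' (μ := timeMeasure T)
    this.stronglyMeasurable).measurable

theorem ae_tendsto_timeAvg {T : ℝ} {ρ : ℕ → ℝ → ℝ} (hρ : ∀ n, Continuous (ρ n))
    (hconv : ∀ g : ℝ → ℝ, LocallyIntegrable g volume →
      ∀ᵐ t, Tendsto (fun n => ∫ s, ρ n (s - t) * g s) atTop (𝓝 (g t)))
    {g : ℝ × Torus d → ℝ} (hg : Measurable g) (hgi : Integrable g (spaceTimeMeasure d T)) :
    ∀ᵐ t ∂(timeMeasure T), ∀ᵐ x : Torus d,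
      Tendsto (fun n => timeAvg T (fun s => ρ n (s - t)) g x) atTop (𝓝 (g (t, x))) := by
  have hm : MeasurableSet {p : ℝ × Torus d |
      Tendsto (fun n => timeAvg T (fun s => ρ n (s - p.1)) g p.2) atTop (𝓝 (g (p.1, p.2)))} :=
    measurableSet_tendsto_fun (fun n => measurable_timeAvg_comp_sub (hρ n) hg) hg
  rw [Measure.ae_ae_comm (p := fun t x => Tendsto (fun n => timeAvg T (fun s => ρ n (s - t)) g x)
    atTop (𝓝 (g (t, x)))) hm]
  filter_upwards [hgi.prod_left_ae] with x hx
  have h1 : Integrable ((Ioo 0 T).indicator fun s => g (s, x)) volume :=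
    (integrable_indicator_iff measurableSet_Ioo).2 hx
  filter_upwards [ae_restrict_of_ae (hconv _ h1.locallyIntegrable),
    ae_restrict_mem measurableSet_Ioo] with t ht htT
  rw [indicator_of_mem htT] at ht
  simpa only [timeAvg, setIntegral_timeMeasure] using ht

/-- Concentrate the weight at a time `t`: the averaged gradients converge almost everywhere to `G i
(t, ·)`, and Fatou's lemma transfers the uniform bound. -/
theorem IsForcedSolution.ae_integral_grad_sq_le (h : IsForcedSolution T κ C M U u F w G)
    (hT : 0 < T) (hκ : 0 < κ) (hC : 0 ≤ C) (i : Fin d) :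
    ∀ᵐ t ∂(timeMeasure T), κ * ∫ x, G i (t, x) ^ 2 ≤ 4 * C ^ 2 * T := by
  obtain ⟨ρ, r, hr, hs, hc, h0, h1, hsup, hconv⟩ := exists_mollifier
  filter_upwards [ae_tendsto_timeAvg (fun n => (hs n).continuous) hconv (h.grad_measurable i)
    ((h.grad_memLp i).integrable one_le_two), ae_restrict_mem measurableSet_Ioo] with t ht htT
  rw [← le_div_iff₀' hκ]
  have hcn : ∀ n, Continuous fun s => ρ n (s - t) := fun n => (hs n).continuous.comp (by fun_prop)
  refine integral_sq_le_of_tendsto (fun n => measurable_timeAvg (hcn n) (h.grad_measurable i))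
    ((h.grad_measurable i).comp measurable_prodMk_left) ht ?_
  have hev : ∀ᶠ n in atTop, t + r n < T := by
    have : Tendsto (fun n => t + r n) atTop (𝓝 (t + 0)) := hr.const_add t
    rw [add_zero] at this
    exact this.eventually_lt_const htT.2
  filter_upwards [hev] with n hn
  have hsc : HasCompactSupport fun s => ρ n (s - t) :=
    (hc n).comp_homeomorph (Homeomorph.subRight t)
  obtain ⟨K, hK⟩ := hsc.exists_bound_of_continuous (hcn n)
  refine ⟨memLp_timeAvg (hcn n) hK (h.grad_measurable i) (h.grad_memLp i), ?_⟩
  rw [le_div_iff₀' hκ]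
  refine le_trans (mul_le_mul_of_nonneg_left ?_ hκ.le)
    (h.sum_integral_timeAvg_grad_sq_le hT hκ.le hC ((hs n).comp (contDiff_id.sub contDiff_const))
      hsc (fun s hs => ?_) (fun s => h0 n _)
      (integral_comp_sub_timeMeasure_le (hs n).continuous (hc n) (h0 n) (h1 n) t))
  · exact Finset.single_le_sum (f := fun i => ∫ x, timeAvg T (fun s => ρ n (s - t)) (G i) x ^ 2)
      (fun j _ => integral_nonneg fun x => sq_nonneg _) (Finset.mem_univ i)
  · have := (abs_le.1 (hsup n _ (tsupport_comp_sub _ _ hs))).2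
    exact mem_Iio.2 (by linarith)

end EnergyEstimate

/-- The dissipation of a weak solution is bounded in time, uniformly in the diffusivity. -/
theorem IsWeakSolution.ae_dissipation_le {T κ : ℝ} (hT : 0 < T)
    (hκ : κ ∈ Ioo (0 : ℝ) 1) {u : Torus d → EuclideanSpace ℝ (Fin d)} (hu : MemLp u ∞ volume)
    (hdiv : IsDivFree u) {θ₀ : Torus d → ℝ} (hθ₀ : TorusContDiff 2 θ₀)
    {θ : ℝ × Torus d → ℝ} {G : ℝ × Torus d → EuclideanSpace ℝ (Fin d)}
    (h : IsWeakSolution T u κ θ₀ θ G) :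
    ∀ᵐ t ∂(timeMeasure T), |κ * ∫ x, ‖G (t, x)‖ ^ 2| ≤
      ∑ i, 2 * (4 * ((eLpNorm u ∞ volume).toReal * normC1 θ₀ + normC2 θ₀) ^ 2 * T +
        supNorm (partialDeriv i θ₀) ^ 2) := by
  obtain ⟨M, w, g, hw, -, hG⟩ := h.exists_isForcedSolution hT hκ hu hdiv hθ₀
  have hθ1 : TorusContDiff 1 θ₀ := hθ₀.of_le (by norm_num)
  have c1 := fun i => hθ1.continuous_partialDeriv i
  have hgi : ∀ᵐ t ∂(timeMeasure T), ∀ i, Integrable (fun x => g i (t, x) ^ 2) volume :=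
    ae_all_iff.2 fun i => (hw.grad_memLp i).integrable_sq.prod_right_ae
  filter_upwards [Measure.ae_ae_of_ae_prod (ae_all_iff.2 hG), hgi,
    ae_all_iff.2 fun i => hw.ae_integral_grad_sq_le hT hκ.1 (lipschitzConst_nonneg u θ₀) i]
    with t h1 h2 h3
  have i2 : ∀ i, Integrable (fun x => partialDeriv i θ₀ x ^ 2) volume := fun i =>
    integrable_of_continuous ((c1 i).pow 2)
  have i3 : ∀ i, Integrable (fun x => 2 * (g i (t, x) ^ 2 + partialDeriv i θ₀ x ^ 2)) volume :=
    fun i => ((h2 i).add (i2 i)).const_mul 2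
  rw [abs_of_nonneg (mul_nonneg hκ.1.le (integral_nonneg fun x => by positivity))]
  -- The gradient of `θ` is that of `w` plus `∇θ₀`; splitting the square accounts for the factor `2`
  -- in the bound.
  have h4 : ∫ x, ‖G (t, x)‖ ^ 2 ≤ ∫ x, ∑ i, 2 * (g i (t, x) ^ 2 + partialDeriv i θ₀ x ^ 2) := by
    refine integral_mono_of_nonneg (ae_of_all _ fun x => by positivity)
      (integrable_finsetSum _ fun i _ => i3 i) ?_
    filter_upwards [h1] with x hx
    rw [EuclideanSpace.norm_sq_eq]
    refine Finset.sum_le_sum fun i _ => ?_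
    rw [hx i, Real.norm_eq_abs, sq_abs]
    exact add_sq_le
  refine (mul_le_mul_of_nonneg_left h4 hκ.1.le).trans ?_
  rw [integral_finsetSum _ fun i _ => i3 i, Finset.mul_sum]
  refine Finset.sum_le_sum fun i _ => ?_
  rw [integral_const_mul, integral_add (h2 i) (i2 i), mul_left_comm, mul_add]
  have h5 : ∫ x, partialDeriv i θ₀ x ^ 2 ≤ supNorm (partialDeriv i θ₀) ^ 2 := by
    refine (integral_mono (i2 i) (integrable_const (supNorm (partialDeriv i θ₀) ^ 2)) fun x => ?_).trans
      (by simp)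
    exact sq_le_sq' (abs_le.1 (abs_le_supNorm (c1 i) x)).1 (abs_le.1 (abs_le_supNorm (c1 i) x)).2
  have h6 : 0 ≤ ∫ x, partialDeriv i θ₀ x ^ 2 := integral_nonneg fun x => sq_nonneg _
  have h7 := h3 i
  have h8 := mul_le_of_le_one_left h6 hκ.2.le
  linarith

end AdvDiff

/-! ### The three claims -/

theorem proposition4p3 (d : ℕ) (hd : 2 ≤ d) (T : ℝ) (hT : 0 < T)
    (u : Torus d → EuclideanSpace ℝ (Fin d)) (hu : MemLp u ∞ volume) (hdiv : IsDivFree u)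
    (θ₀ : Torus d → ℝ) (hθ₀ : TorusContDiff 2 θ₀)
    (θ : ℝ → ℝ × Torus d → ℝ) (G : ℝ → ℝ × Torus d → EuclideanSpace ℝ (Fin d))
    (hθ : ∀ κ ∈ Ioo (0 : ℝ) 1, IsWeakSolution T u κ θ₀ (θ κ) (G κ)) :
    -- `∂_t θ_κ` is bounded, uniformly in `κ`
    (∀ κ ∈ Ioo (0 : ℝ) 1, ∃ g : ℝ × Torus d → ℝ,
      HasWeakTimeDeriv T (θ κ) g ∧ MemLp g ∞ (spaceTimeMeasure d T) ∧
      eLpNorm g ∞ (spaceTimeMeasure d T) ≤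
        ENNReal.ofReal ((eLpNorm u ∞ volume).toReal * normC1 θ₀ + normC2 θ₀)) ∧
    -- weak-* compactness of the dissipation
    (∀ κ : ℕ → ℝ, (∀ n, κ n ∈ Ioo (0 : ℝ) 1) → Tendsto κ atTop (𝓝 0) →
      ∃ m : ℕ → ℕ, StrictMono m ∧ ∃ f : ℝ → ℝ,
        TendstoWeakStar (timeMeasure T)
          (fun n t => κ (m n) * ∫ x, ‖G (κ (m n)) (t, x)‖ ^ 2) f) ∧
    -- the energy of any weak-* limit is Lipschitz in time
    (∀ κ : ℕ → ℝ, (∀ n, κ n ∈ Ioo (0 : ℝ) 1) → Tendsto κ atTop (𝓝 0) →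
      ∀ ϑ : ℝ × Torus d → ℝ,
        TendstoWeakStar (spaceTimeMeasure d T) (fun n => θ (κ n)) ϑ →
        MemW1Infty T (fun t => ∫ x, ϑ (t, x) ^ 2)) := by
  have hC := lipschitzConst_nonneg u θ₀
  refine ⟨fun κ hκ => ?_, fun κ hκ _ => ?_, fun κ hκ _ ϑ hϑ => ?_⟩
  · obtain ⟨M, f, hf, hM, hae, hL⟩ :=
      (hθ κ hκ).exists_lipschitz_representative hT hκ hu hdiv hθ₀
    obtain ⟨g, hg, hgL, hgC⟩ := exists_hasWeakTimeDeriv hC hf hM hL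
    refine ⟨g, hg.congr_ae hae, hgL, ?_⟩
    rw [eLpNorm_exponent_top]
    exact eLpNormEssSup_le_of_ae_bound hgC
  · refine (exists_subseq_tendstoWeakStar (μ := timeMeasure T)
      (F := fun n t => κ n * ∫ x, ‖G (κ n) (t, x)‖ ^ 2) (fun n => ?_)
      (fun n => (hθ _ (hκ n)).ae_dissipation_le hT (hκ n) hu hdiv hθ₀)
      (Finset.sum_nonneg fun i _ => by positivity)).imp
      fun m hm => ⟨hm.1, hm.2.imp fun f hf => hf.2⟩
    exact ((hθ _ (hκ n)).grad_memLp.1.norm.pow 2).integral_prod_right'.const_mul _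
  · obtain ⟨g, M, hg, hgM, hae⟩ := exists_measurable_bdd_representative hϑ.2.1
    -- The sup bounds `B n` may vary with `n`; only the Lipschitz constant must be common to all
    -- `n`, while boundedness of the limit comes from `g`.
    choose B f hf hM hfae hL using fun n =>
      (hθ _ (hκ n)).exists_lipschitz_representative hT (hκ n) hu hdiv hθ₀
    have hlim : TendstoWeakStar (spaceTimeMeasure d T) f g := by
      refine ⟨fun n => (memLp_congr_ae (hfae n)).1 (hϑ.1 n), (memLp_congr_ae hae).1 hϑ.2.1,
        fun ψ hψ => ?_⟩
      have h1 := hϑ.2.2 ψ hψ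
      rw [integral_congr_ae (g := fun p => g p * ψ p) (hae.mono fun p hp => by simp only [hp])] at h1
      refine h1.congr fun n => integral_congr_ae ?_
      filter_upwards [hfae n] with p hp
      rw [hp]
    refine (memW1Infty_energy hC hg hgM fun δ hδ => hlim.ae_abs_sub_le hδ hf
      (fun n => ⟨B n, hM n⟩) (fun n => hL n δ hδ) hg hgM).congr_ae ?_
    filter_upwards [Measure.ae_ae_of_ae_prod hae] with t ht
    refine integral_congr_ae ?_
    filter_upwards [ht] with x hx
    rw [hx]
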